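/- Let $M\in\mathbb{R}^{3\times 3}$ be symmetric with $G:=\operatorname{tr}(M)I-M$ positive definite, and let $(v_1,v_2,v_3)$ be an orthonormal basis of eigenvectors of $M$, $Mv_i=\lambda_i^M v_i$; write $\lambda_i^G$ for the eigenvalue of $G$ at $v_i$, $\lambda_{\min}^G,\lambda_{\max}^G$ for the extreme eigenvalues of $G$, and $\xi=\lambda_{\min}^G/\lambda_{\max}^G$. Let $\Psi_M(X)=\operatorname{tr}(M(I-X))$, let $0<k<1/\sqrt{6-\max\{1,4\xi^2\}}$, and for $X\in \mathrm{SO}(3)$ let $$\theta(X)=2\arcsin\Big(\frac{k\,\Psi_M(X)}{2\lambda_{\max}^G}\Big).$$ Let $\mathcal R_a(\theta,u)=I+\sin\theta\,u^\wedge+(1-\cos\theta)(u^\wedge)^2$, where $u^\wedge$ is the skew-symmetric matrix with $u^\wedge y=u\times y$. Let $\mathcal Q\subset\mathbb N$ be finite, and let $u_q$ ($q\in\mathcal Q$) be unit vectors, $\mathcal U=\{u_q:q\in\mathcal Q\}$. Put $$V(X,q)=\Psi_M\big(X\,\mathcal R_a(\theta(X),u_q)\big),\qquad (X,q)\in\mathrm{SO}(3)\times\mathcal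 Q .$$ For each $q$ let $\mathcal Q_q\subseteq\mathcal Q$ and $\mathcal U_q=\{u_p:p\in\mathcal Q_q\}$, let $\pi_V(X,q)=V(X,q)-\min_{p\in\mathcal Q_q}V(X,p)$, and let $$\bar\delta_q=\min\{\pi_V(X,q): X\neq I,\ X \text{ a critical point of } V(\cdot,q) \text{ on } \mathrm{SO}(3)\}.$$ Put $$\Xi_1=\frac{2k}{1+\sqrt{1+4k^2}},\quad \Xi_{21}=\frac{2k}{1+\sqrt{1+4k^2(1-\xi)}},\quad \Xi_{22}=\frac{2k\xi}{1+\sqrt{1+4k^2\xi^2}}.$$ In each of the following cases the minimum $\bar\delta_q$ is attained for every $q\in\mathcal Q$, and: 1. If $\lambda_1^M=\lambda_2^M=\lambda_3^M=\lambda>0$, $\mathcal U=\{\pm v_1,\pm v_2,\pm v_3\}$ and $\mathcal U_q=\{w\in\mathcal U:w^\top u_q=0\}$ for all $q$, then for every $q\in\mathcal Q$ $$\bar\delta_q=2\lambda\min\{k^2,\ 2\Xi_1^2(1-\Xi_1^2)\}>0 .$$ 2. If $\lambda_1^M=\lambda_2^M>\lambda_3^M>0$, $\mathcal U=\{\pm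 v_1,\pm v_2\}$ and $\mathcal U_q=\{w\in\mathcal U:w^\top u_q=0\}$ for all $q$, then for every $q\in\mathcal Q$ $$\bar\delta_q=2\lambda_3^G\min\{\Xi_{21}^2(1+(1-2\xi)(1-\Xi_{21}^2)),\ \Xi_{22}^2(1-\Xi_{22}^2)(2\xi-1)\}>0 .$$ 3. If $\lambda_1^M=\lambda_2^M>\lambda_3^M\ge 0$, $\mathcal U=\{v_1\cos(n\pi/3)+v_2\sin(n\pi/3):n\in\mathbb Z\}$ and $\mathcal U_q=\{-u_q\}\cup\{w\in\mathcal U:w^\top u_q=\tfrac12\}$ for all $q$, then for every $q\in\mathcal Q$ $$\bar\delta_q\ \ge\ \lambda_3^G\min\Big\{\max\big\{\tfrac12\Xi_{21}^2(3+(1-4\xi)(1-\Xi_{21}^2)),\ 8\Xi_{21}^2(1-\Xi_{21}^2)(1-\xi)\big\},\ 2\Xi_{22}^2(1-\Xi_{22}^2)(\xi-\tfrac14)\Big\}>0 .$$ -/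

import Mathlib

open Matrix

noncomputable section

namespace Synergy

/-- Vectors of `ℝ³` as coordinate vectors; the Euclidean inner product is `x ⬝ᵥ y`. -/
abbrev Vec := Fin 3 → ℝ

/-- Real `3 × 3` matrices. -/
abbrev Mat := Matrix (Fin 3) (Fin 3) ℝ

/-- The rotation group `SO(3)`. -/
abbrev SO3 := Matrix.specialOrthogonalGroup (Fin 3) ℝ

/-- The skew-symmetric matrix `x^∧`, with `x^∧ y = x × y`. -/
def hat (x : Vec) : Mat :=
  !![0, -x 2, x 1;
     x 2, 0, -x 0;
     -x 1, x 0, 0]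

/-- The map `Ω ↦ Ω^∨`, inverse to `hat` on skew-symmetric matrices. -/
def vee (W : Mat) : Vec := ![W 2 1, W 0 2, W 1 0]

/-- The antisymmetric projection `(A - Aᵀ) / 2`. -/
def antisymPart (A : Mat) : Mat := (1 / 2 : ℝ) • (A - Aᵀ)

/-- `ψ(A) = (ℙₐ(A))^∨`. -/
def psi (A : Mat) : Vec := vee (antisymPart A)

/-- The Rodrigues formula: rotation by the angle `t` about the axis `u`. -/
def rodrigues (t : ℝ) (u : Vec) : Mat :=
  1 + Real.sin t • hat u + (1 - Real.cos t) • (hat u * hat u)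

/-- `W` is the gradient at `X` of `f : SO(3) → ℝ` for the Frobenius inner product
`⟨A, B⟩ = tr (Aᵀ B)`: it is tangent to `SO(3)` at `X`, and `f` has derivative `⟨W, γ'(0)⟩` along
every curve `γ` in `SO(3)` through `X` that is differentiable at `0`. -/
def IsGradientAt (f : SO3 → ℝ) (X : SO3) (W : Mat) : Prop :=
  (∃ S : Mat, Sᵀ = -S ∧ W = (X : Mat) * S) ∧
  ∀ (c : ℝ → SO3) (c' : Mat), c 0 = X →
    (∀ i j, HasDerivAt (fun t => (c t : Mat) i j) (c' i j) 0) →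
    HasDerivAt (fun t => f (c t)) (Wᵀ * c').trace 0

/-- The set of critical points `(X, q) ∈ SO(3) × Q` of a family `V`, where
`ρ_V (X, q) = ψ (Xᵀ ∇V (X, q))` vanishes. -/
def Crit (Q : Finset ℕ) (V : SO3 → ℕ → ℝ) : Set (SO3 × ℕ) :=
  {z | z.2 ∈ Q ∧ ∃ W : Mat, IsGradientAt (fun X => V X z.2) z.1 W ∧ psi ((z.1 : Mat)ᵀ * W) = 0}

/-- The set of desired points `{I} × Q`. -/
def desired (Q : Finset ℕ) : Set (SO3 × ℕ) := {z | z.1 = 1 ∧ z.2 ∈ Q}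

/-- The refined gap `V (X, q) - min_{p ∈ Q_q} V (X, p)`, where `Qs q` is `Q_q`. For a nonempty
finite `Q_q` the infimum is the minimum. -/
def refinedGap (V : SO3 → ℕ → ℝ) (Qs : ℕ → Finset ℕ) (X : SO3) (q : ℕ) : ℝ :=
  V X q - sInf ((fun p => V X p) '' (Qs q : Set ℕ))

/-- The values of the refined gap at the unwanted critical points with index `q`. -/
def gapValues (Q : Finset ℕ) (V : SO3 → ℕ → ℝ) (Qs : ℕ → Finset ℕ) (q : ℕ) : Set ℝ :=
  {r | ∃ z ∈ Crit Q V \ desired Q, z.2 = q ∧ r = refinedGap V Qs z.1 z.2}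

/-- The matrix `G = tr(M) I - M`. -/
def gMat (M : Mat) : Mat := M.trace • (1 : Mat) - M

/-- The modified trace function `tr (M (I - X))`. -/
def Psi (M : Mat) (X : Mat) : ℝ := (M * (1 - X)).trace

/-- The largest eigenvalue (of a symmetric matrix). -/
def lamMax (A : Mat) : ℝ := sSup (spectrum ℝ A)

/-- The smallest eigenvalue (of a symmetric matrix). -/
def lamMin (A : Mat) : ℝ := sInf (spectrum ℝ A)

/-- The ratio `ξ` of the extreme eigenvalues of `G`. -/
def xi (M : Mat) : ℝ := lamMin (gMat M) / lamMax (gMat M)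

/-- The warping angle with gain `k`. -/
def warpAngle (M : Mat) (k : ℝ) (X : SO3) : ℝ :=
  2 * Real.arcsin (k / (2 * lamMax (gMat M)) * Psi M X)

/-- The angular warping `X ↦ X R(θ(X), u_q)`. -/
def warp (M : Mat) (k : ℝ) (u : ℕ → Vec) (X : SO3) (q : ℕ) : Mat :=
  (X : Mat) * rodrigues (warpAngle M k X) (u q)

/-- The warped family `V (X, q) = Ψ_M (X R(θ(X), u_q))`. -/
def warpedV (M : Mat) (k : ℝ) (u : ℕ → Vec) (X : SO3) (q : ℕ) : ℝ :=
  Psi M (warp M k u X q)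

/-- The number `δ̄_q` of the warped family: the minimal refined gap over the unwanted critical
points with index `q` (the theorem also asserts that this infimum is attained). -/
def deltaBar (M : Mat) (k : ℝ) (Q : Finset ℕ) (u : ℕ → Vec) (Qs : ℕ → Finset ℕ) (q : ℕ) : ℝ :=
  sInf (gapValues Q (warpedV M k u) Qs q)

/-- `v` is an orthonormal basis of `ℝ³` of eigenvectors of `M`, with eigenvalues `lam`. -/
def IsOrthonormalEigenbasis (M : Mat) (lam : Fin 3 → ℝ) (v : Fin 3 → Vec) : Prop :=
  (∀ i j, v i ⬝ᵥ v j = if i = j then 1 else 0) ∧ ∀ i, M *ᵥ v i = lam i • v i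

/-- `u` enumerates over `Q` the set `U` of warping directions, and for each `q ∈ Q` the set `Q_q`
is a subset of `Q` whose set of directions is `Us (u q)`. -/
def HasDirections (Q : Finset ℕ) (u : ℕ → Vec) (Qs : ℕ → Finset ℕ) (U : Set Vec)
    (Us : Vec → Set Vec) : Prop :=
  u '' (Q : Set ℕ) = U ∧ ∀ q ∈ Q, Qs q ⊆ Q ∧ u '' (Qs q : Set ℕ) = Us (u q)

/-- `{±v₁, ±v₂, ±v₃}`. -/
def dirs6 (v : Fin 3 → Vec) : Set Vec := {v 0, -v 0, v 1, -v 1, v 2, -v 2}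

/-- `{±v₁, ±v₂}`. -/
def dirs4 (v : Fin 3 → Vec) : Set Vec := {v 0, -v 0, v 1, -v 1}

/-- `{v₁ cos (nπ/3) + v₂ sin (nπ/3) : n ∈ ℤ}`. -/
def dirsHex (v : Fin 3 → Vec) : Set Vec :=
  {x | ∃ n : ℤ, x = Real.cos (n * Real.pi / 3) • v 0 + Real.sin (n * Real.pi / 3) • v 1}

/-- The directions of `U` orthogonal to `w`. -/
def perpDirs (U : Set Vec) (w : Vec) : Set Vec := {x | x ∈ U ∧ x ⬝ᵥ w = 0}

/-- The direction `-w` and the directions of `U` at angle `π/3` to `w`. -/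
def hexNeighbours (U : Set Vec) (w : Vec) : Set Vec := {-w} ∪ {x | x ∈ U ∧ x ⬝ᵥ w = 1 / 2}

/-- `Ξ₁ = 2k / (1 + √(1 + 4k²))`. -/
def Xi1 (k : ℝ) : ℝ := 2 * k / (1 + √(1 + 4 * k ^ 2))

/-- `Ξ₂₁ = 2k / (1 + √(1 + 4k²(1 - ξ)))`. -/
def Xi21 (k ξ : ℝ) : ℝ := 2 * k / (1 + √(1 + 4 * k ^ 2 * (1 - ξ)))

/-- `Ξ₂₂ = 2kξ / (1 + √(1 + 4k²ξ²))`. -/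
def Xi22 (k ξ : ℝ) : ℝ := 2 * k * ξ / (1 + √(1 + 4 * k ^ 2 * ξ ^ 2))

/-- The value of `δ̄_q` for a triple eigenvalue `μ` of `M`. -/
def gapTriple (k μ : ℝ) : ℝ :=
  2 * μ * min (k ^ 2) (2 * Xi1 k ^ 2 * (1 - Xi1 k ^ 2))

/-- The value of `δ̄_q` for a double largest eigenvalue of `M` and four directions. -/
def gapFour (k ξ g₃ : ℝ) : ℝ :=
  2 * g₃ * min
    (Xi21 k ξ ^ 2 * (1 + (1 - 2 * ξ) * (1 - Xi21 k ξ ^ 2)))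
    (Xi22 k ξ ^ 2 * (1 - Xi22 k ξ ^ 2) * (2 * ξ - 1))

/-- The lower bound of `δ̄_q` for a double largest eigenvalue of `M` and six coplanar directions. -/
def gapHex (k ξ g₃ : ℝ) : ℝ :=
  g₃ * min
    (max (1 / 2 * Xi21 k ξ ^ 2 * (3 + (1 - 4 * ξ) * (1 - Xi21 k ξ ^ 2)))
      (8 * Xi21 k ξ ^ 2 * (1 - Xi21 k ξ ^ 2) * (1 - ξ)))
    (2 * Xi22 k ξ ^ 2 * (1 - Xi22 k ξ ^ 2) * (ξ - 1 / 4))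

end Synergy

end

noncomputable section

namespace Synergy

/-! Write a rotation as a unit quaternion `(η, e)`. In all three cases `M` has a repeated
eigenvalue, so `G = g I + h n nᵀ` with `h ≥ 0`, and `Ψ_M` of the rotation is `2 eᵀGe` (`Psi_quat`).
Warping multiplies the quaternion by `(c, s u)`, where `s = sin(θ/2) = k eᵀGe / (g + h)` lies in
`[0, k]`. The gain condition gives `k² < 1/2`, which keeps the derivative factor `1 + dθ` along the
warping axis nonzero. Hence critical points of `V` are exactly the points warped to critical points
of `Ψ_M` (`mem_crit_iff`): the identity, which comes only from `X = I`, and half-turns about unit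
eigenvectors `e` of `G`.

Undoing the warp at such a half-turn leaves a scalar equation for `s`, so an unwanted critical point
is a triple `(e, s, c)` as in `IsCritConfig`. Its refined gap is the largest `gain` over the
neighbouring directions (`mem_gapValues_iff`), and the problem becomes a min-max over `(e, s, c)`.
The triples form a compact set, so the minimum is attained.

For `h > 0`, put `L = g + h`; then either `e = ±n` or `e ⊥ n`. On the axis, `s = Ξ₂₁` and the gains
are explicit. On the equator, `s ≥ Ξ₂₂` and the gain is `s²(1 - s²)` times a quadratic in the planar
coordinates of `e`; the first factor increases in `s` because `s² ≤ k² < 1/2`. With four directions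
both estimates are sharp at `e = u`, which gives equality. With six they are sharp at different `e`,
which gives only a lower bound on the equator.

For `h = 0` every axis `e` is allowed and the gain is a multiple of the squared scalar part of a
quaternion. `triple_lower_bound` interpolates between `e ⊥ u`, where `s = k`, and `e = ±u`, where `s
= Ξ₁`; these ends give the two terms of the minimum. -/

/-! ### Unit quaternions and rotation matrices. -/

/-- The rotation matrix of the quaternion with scalar part `η` and vector part `e`. -/
def quat (η : ℝ) (e : Vec) : Mat :=
  1 + (2 * η) • hat e + (2 : ℝ) • (hat e * hat e)

theorem dot_eq (x y : Vec) : x ⬝ᵥ y = x 0 * y 0 + x 1 * y 1 + x 2 * y 2 := by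
  simp [dotProduct, Fin.sum_univ_three]

theorem cross_zero (x y : Vec) : (x ⨯₃ y) 0 = x 1 * y 2 - x 2 * y 1 := by simp [cross_apply]
theorem cross_one (x y : Vec) : (x ⨯₃ y) 1 = x 2 * y 0 - x 0 * y 2 := by simp [cross_apply]
theorem cross_two (x y : Vec) : (x ⨯₃ y) 2 = x 0 * y 1 - x 1 * y 0 := by simp [cross_apply]

theorem quat_eq (η : ℝ) (e : Vec) : quat η e =
    !![1 - 2 * (e 1 ^ 2 + e 2 ^ 2), 2 * (e 0 * e 1 - η * e 2), 2 * (e 0 * e 2 + η * e 1);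
       2 * (e 0 * e 1 + η * e 2), 1 - 2 * (e 0 ^ 2 + e 2 ^ 2), 2 * (e 1 * e 2 - η * e 0);
       2 * (e 0 * e 2 - η * e 1), 2 * (e 1 * e 2 + η * e 0), 1 - 2 * (e 0 ^ 2 + e 1 ^ 2)] := by
  ext i j
  fin_cases i <;> fin_cases j <;>
    simp [quat, hat] <;> ring

/-- Replacing `1` by the squared norm makes every entry homogeneous of degree two. Multiplicativity
then becomes a polynomial identity, and the determinant becomes the cube of the squared norm. -/
theorem quat_eq_of_norm {η : ℝ} {e : Vec} (h : η ^ 2 + e ⬝ᵥ e = 1) : quat η e =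
    !![η ^ 2 + e 0 ^ 2 - e 1 ^ 2 - e 2 ^ 2, 2 * (e 0 * e 1 - η * e 2), 2 * (e 0 * e 2 + η * e 1);
       2 * (e 0 * e 1 + η * e 2), η ^ 2 - e 0 ^ 2 + e 1 ^ 2 - e 2 ^ 2, 2 * (e 1 * e 2 - η * e 0);
       2 * (e 0 * e 2 - η * e 1), 2 * (e 1 * e 2 + η * e 0),
        η ^ 2 - e 0 ^ 2 - e 1 ^ 2 + e 2 ^ 2] := by
  rw [dot_eq] at h
  rw [quat_eq]
  ext i j
  fin_cases i <;> fin_cases j <;> simp <;> linarith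

theorem quat_norm_mul {η η' : ℝ} {e e' : Vec} (h : η ^ 2 + e ⬝ᵥ e = 1)
    (h' : η' ^ 2 + e' ⬝ᵥ e' = 1) :
    (η * η' - e ⬝ᵥ e') ^ 2 +
      (η • e' + η' • e + e ⨯₃ e') ⬝ᵥ (η • e' + η' • e + e ⨯₃ e') = 1 := by
  simp only [dot_eq, Pi.add_apply, Pi.smul_apply, smul_eq_mul, cross_zero, cross_one,
    cross_two] at *
  linear_combination (η' ^ 2 + (e' 0 * e' 0 + e' 1 * e' 1 + e' 2 * e' 2)) * h + h'

theorem quat_mul {η η' : ℝ} {e e' : Vec} (h : η ^ 2 + e ⬝ᵥ e = 1) (h' : η' ^ 2 + e' ⬝ᵥ e' = 1) :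
    quat η e * quat η' e' =
      quat (η * η' - e ⬝ᵥ e') (η • e' + η' • e + e ⨯₃ e') := by
  rw [quat_eq_of_norm h, quat_eq_of_norm h', quat_eq_of_norm (quat_norm_mul h h')]
  simp only [dot_eq, Pi.add_apply, Pi.smul_apply, smul_eq_mul, cross_zero, cross_one,
    cross_two]
  ext i j
  fin_cases i <;> fin_cases j <;>
    simp [Matrix.mul_apply, Fin.sum_univ_three] <;> ring

theorem quat_transpose (η : ℝ) (e : Vec) : (quat η e)ᵀ = quat η (-e) := by
  simp only [quat_eq, Pi.neg_apply]
  ext i j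
  fin_cases i <;> fin_cases j <;> simp <;> ring

theorem rodrigues_eq_quat (t : ℝ) (u : Vec) :
    rodrigues t u = quat (Real.cos (t / 2)) (Real.sin (t / 2) • u) := by
  have h1 : Real.sin t = 2 * Real.sin (t / 2) * Real.cos (t / 2) := by
    rw [← Real.sin_two_mul]; ring_nf
  have h2 : Real.cos t = 1 - 2 * Real.sin (t / 2) ^ 2 := by
    rw [← Real.cos_sq_add_sin_sq (t / 2)]
    have := Real.cos_two_mul' (t / 2)
    rw [show 2 * (t / 2) = t by ring] at this
    linarith
  rw [quat_eq]
  ext i j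
  fin_cases i <;> fin_cases j <;>
    simp [rodrigues, hat, h1, h2] <;> ring

theorem quat_mul_transpose {η : ℝ} {e : Vec} (h : η ^ 2 + e ⬝ᵥ e = 1) :
    quat η e * (quat η e)ᵀ = 1 := by
  rw [quat_transpose, quat_mul h (by simpa using h)]
  have h1 : η • -e + η • e + e ⨯₃ (-e) = 0 := by simp
  rw [h1, quat_eq]
  ext i j; fin_cases i <;> fin_cases j <;> simp

theorem quat_mem {η : ℝ} {e : Vec} (h : η ^ 2 + e ⬝ᵥ e = 1) :
    quat η e ∈ Matrix.specialOrthogonalGroup (Fin 3) ℝ := by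
  rw [Matrix.mem_specialOrthogonalGroup_iff, Matrix.mem_orthogonalGroup_iff]
  refine ⟨quat_mul_transpose h, ?_⟩
  rw [quat_eq_of_norm h, Matrix.det_fin_three]
  rw [dot_eq] at h
  simp only [of_apply, cons_val', cons_val_zero, cons_val_one, cons_val]
  set N := η ^ 2 + (e 0 * e 0 + e 1 * e 1 + e 2 * e 2) with hN
  trans N ^ 3
  · rw [hN]; ring
  · rw [h]; norm_num

/-- A symmetric rank-one matrix is recovered from any row with positive diagonal entry, after
rescaling; the trace guarantees such a row. The factor 4 matches the normalization of the matrix of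
quaternion products. -/
theorem exists_rank_one {P : Fin 4 → Fin 4 → ℝ} (htr : ∑ a, P a a = 4)
    (hP : ∀ a b c, P a a * P b c = P a b * P a c) :
    ∃ q : Fin 4 → ℝ, ∀ b c, P b c = 4 * (q b * q c) := by
  obtain ⟨a, ha⟩ : ∃ a, 0 < P a a := by
    by_contra! hc
    have := Finset.sum_nonpos (s := Finset.univ) fun a _ => hc a
    linarith
  refine ⟨fun b => P a b / (2 * √(P a a)), fun b c => ?_⟩
  have h1 : √(P a a) ^ 2 = P a a := Real.sq_sqrt ha.le
  have h2 : √(P a a) ≠ 0 := (Real.sqrt_pos.mpr ha).ne'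
  have h3 := hP a b c
  field_simp
  rw [h1]
  linarith

theorem orthogonal_relations (X : SO3) :
    (X : Mat) * (X : Mat)ᵀ = 1 ∧ (X : Mat)ᵀ * (X : Mat) = 1 ∧ (X : Mat).adjugate = (X : Mat)ᵀ := by
  have h := X.2
  rw [Matrix.mem_specialOrthogonalGroup_iff, Matrix.mem_orthogonalGroup_iff] at h
  obtain ⟨h1, h2⟩ := h
  have h1 : (X : Mat) * (X : Mat)ᵀ = 1 := h1
  have h3 := mul_eq_one_comm.mp h1
  refine ⟨h1, h3, ?_⟩
  have h4 := Matrix.mul_adjugate (X : Mat)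
  rw [h2, one_smul] at h4
  calc (X : Mat).adjugate = ((X : Mat)ᵀ * X) * (X : Mat).adjugate := by rw [h3, one_mul]
    _ = _ := by rw [mul_assoc, h4, mul_one]

/-- Every rotation matrix comes from a unit quaternion. -/
theorem exists_quat (X : SO3) : ∃ (η : ℝ) (e : Vec), η ^ 2 + e ⬝ᵥ e = 1 ∧ (X : Mat) = quat η e := by
  obtain ⟨h1, h2, h3⟩ := orthogonal_relations X
  generalize (X : Mat) = m at *
  have ha : ∀ i j, (m * mᵀ) i j = (1 : Mat) i j := fun i j => by rw [h1]
  have hb : ∀ i j, (mᵀ * m) i j = (1 : Mat) i j := fun i j => by rw [h2]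
  have hc : ∀ i j, m.adjugate i j = mᵀ i j := fun i j => by rw [h3]
  simp only [Matrix.adjugate_fin_three, Fin.forall_fin_succ, Matrix.mul_apply,
    Fin.sum_univ_three, Matrix.transpose_apply, Matrix.one_apply] at ha hb hc
  simp at ha hb hc
  -- For `m = quat η e` this matrix is four times the outer square of `(η, e)`. The vanishing of the
  -- needed minors uses both orthogonality relations and `adjugate = transpose`, which is where
  -- determinant one enters.
  obtain ⟨q, hq⟩ := exists_rank_one (P := !![1 + m 0 0 + m 1 1 + m 2 2, m 2 1 - m 1 2,
      m 0 2 - m 2 0, m 1 0 - m 0 1;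
    m 2 1 - m 1 2, 1 + m 0 0 - m 1 1 - m 2 2, m 0 1 + m 1 0, m 0 2 + m 2 0;
    m 0 2 - m 2 0, m 0 1 + m 1 0, 1 - m 0 0 + m 1 1 - m 2 2, m 1 2 + m 2 1;
    m 1 0 - m 0 1, m 0 2 + m 2 0, m 1 2 + m 2 1, 1 - m 0 0 - m 1 1 + m 2 2])
    (by simp [Fin.sum_univ_four]; ring)
    (by
      intro a b c
      fin_cases a <;> fin_cases b <;> fin_cases c <;> simp <;> linarith)
  simp [Fin.forall_fin_succ] at hq
  refine ⟨q 0, ![q 1, q 2, q 3], ?_, ?_⟩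
  · simp only [dot_eq, cons_val]
    linarith
  · rw [quat_eq]
    ext i j
    fin_cases i <;> fin_cases j <;> simp <;> linarith

/-! ### Symmetry tested against skew matrices. -/

theorem trace_mul_hat (A : Mat) (w : Vec) : (A * hat w).trace =
    w 0 * (A 1 2 - A 2 1) + w 1 * (A 2 0 - A 0 2) + w 2 * (A 0 1 - A 1 0) := by
  simp [Matrix.trace, Matrix.mul_apply, Fin.sum_univ_three, hat]
  ring

/-- The trace pairs `w` with the antisymmetric part of `A`. Only unit `w` are needed because
`rodrigues t w` is a curve in `SO(3)` only for these. -/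
theorem isSymm_of_trace_mul_hat {A : Mat} (h : ∀ w : Vec, w ⬝ᵥ w = 1 → (A * hat w).trace = 0) :
    A.IsSymm := by
  simp only [trace_mul_hat, dot_eq] at h
  have h0 := h ![1, 0, 0] (by simp)
  have h1 := h ![0, 1, 0] (by simp)
  have h2 := h ![0, 0, 1] (by simp)
  simp at h0 h1 h2
  ext i j
  fin_cases i <;> fin_cases j <;> simp <;> linarith

theorem trace_symm_mul_skew {A S : Mat} (hA : A.IsSymm) (hS : Sᵀ = -S) : (A * S).trace = 0 := by
  have h : (A * S).trace = -(A * S).trace := by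
    conv_lhs => rw [← Matrix.trace_transpose, Matrix.transpose_mul, hS, hA.eq, Matrix.neg_mul,
      Matrix.trace_neg, Matrix.trace_mul_comm]
  linarith

theorem hat_transpose (w : Vec) : (hat w)ᵀ = -hat w := by
  ext i j
  fin_cases i <;> fin_cases j <;> simp [hat]

theorem isSymm_iff_trace_mul_hat {A : Mat} : A.IsSymm ↔ ∀ w : Vec, (A * hat w).trace = 0 :=
  ⟨fun h w => trace_symm_mul_skew h (hat_transpose w),
    fun h => isSymm_of_trace_mul_hat fun w _ => h w⟩

theorem hat_cube {u : Vec} (hu : u ⬝ᵥ u = 1) : hat u * hat u * hat u = -hat u := by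
  rw [dot_eq] at hu
  ext i j
  fin_cases i <;> fin_cases j <;> simp [hat] <;> grind

/-- The right side is the derivative of `rodrigues t u` in `t`, so the angular velocity is `hat u`.
-/
theorem rodrigues_mul_hat (t : ℝ) {u : Vec} (hu : u ⬝ᵥ u = 1) :
    rodrigues t u * hat u = Real.cos t • hat u + Real.sin t • (hat u * hat u) := by
  simp only [rodrigues, add_mul, one_mul, smul_mul_assoc, hat_cube hu]
  module

theorem rodrigues_hat_comm (t : ℝ) (u : Vec) :
    hat u * rodrigues t u = rodrigues t u * hat u := by
  simp only [rodrigues, add_mul, mul_add, one_mul, mul_one, smul_mul_assoc, mul_smul_comm,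
    mul_assoc]

theorem sin_smul_norm (t : ℝ) {u : Vec} (hu : u ⬝ᵥ u = 1) :
    Real.cos t ^ 2 + (Real.sin t • u) ⬝ᵥ (Real.sin t • u) = 1 := by
  rw [smul_dotProduct, dotProduct_smul, hu]
  simp [← sq]

theorem rodrigues_mem (t : ℝ) {u : Vec} (hu : u ⬝ᵥ u = 1) :
    rodrigues t u ∈ Matrix.specialOrthogonalGroup (Fin 3) ℝ := by
  rw [rodrigues_eq_quat]
  exact quat_mem (sin_smul_norm _ hu)

theorem rodrigues_mul_transpose (t : ℝ) {u : Vec} (hu : u ⬝ᵥ u = 1) :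
    rodrigues t u * (rodrigues t u)ᵀ = 1 := by
  rw [rodrigues_eq_quat]
  exact quat_mul_transpose (sin_smul_norm _ hu)

/-! ### Derivatives of the warped function and its critical points. -/

theorem hasDerivAt_trace_mul_mul {C : ℝ → Mat} {C' : Mat} {x : ℝ} (A B : Mat)
    (hC : ∀ i j, HasDerivAt (fun t => C t i j) (C' i j) x) :
    HasDerivAt (fun t => (A * C t * B).trace) (A * C' * B).trace x := by
  simp only [Matrix.trace, Matrix.diag, Matrix.mul_apply]
  exact HasDerivAt.fun_sum fun i _ => HasDerivAt.fun_sum fun j _ =>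
    (HasDerivAt.fun_sum fun l _ => (hC l j).const_mul _).mul_const _

theorem hasDerivAt_Psi {C : ℝ → Mat} {C' : Mat} {x : ℝ} (M : Mat)
    (hC : ∀ i j, HasDerivAt (fun t => C t i j) (C' i j) x) :
    HasDerivAt (fun t => Psi M (C t)) (-(M * C').trace) x := by
  have h := (hasDerivAt_trace_mul_mul M 1 hC).const_sub M.trace
  simpa [Psi, mul_sub] using h

/-- The directional derivative of the warping angle along `C'`. -/
def angleDeriv (M : Mat) (k : ℝ) (X : SO3) (C' : Mat) : ℝ :=
  2 * (1 / √(1 - (k / (2 * lamMax (gMat M)) * Psi M X) ^ 2) *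
    (k / (2 * lamMax (gMat M)) * -(M * C').trace))

theorem hasDerivAt_warpAngle {M : Mat} {k : ℝ} {c : ℝ → SO3} {C' : Mat} {X : SO3} (h0 : c 0 = X)
    (hC : ∀ i j, HasDerivAt (fun t => (c t : Mat) i j) (C' i j) 0)
    (hlt : |k / (2 * lamMax (gMat M)) * Psi M X| < 1) :
    HasDerivAt (fun t => warpAngle M k (c t)) (angleDeriv M k X C') 0 := by
  rw [abs_lt] at hlt
  have h1 := (hasDerivAt_Psi M hC).const_mul (k / (2 * lamMax (gMat M)))
  have h2 : HasDerivAt Real.arcsin (1 / √(1 - (k / (2 * lamMax (gMat M)) * Psi M X) ^ 2))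
      (k / (2 * lamMax (gMat M)) * Psi M (c 0)) := by
    rw [h0]
    exact Real.hasDerivAt_arcsin (by linarith) (by linarith)
  exact (h2.comp (0 : ℝ) h1).const_mul 2

theorem hasDerivAt_Psi_rodrigues {M : Mat} {φ : ℝ → ℝ} {φ' : ℝ} {C : ℝ → Mat} {C' : Mat} {u : Vec}
    {x : ℝ} (hu : u ⬝ᵥ u = 1) (hC : ∀ i j, HasDerivAt (fun t => C t i j) (C' i j) x)
    (hφ : HasDerivAt φ φ' x) :
    HasDerivAt (fun t => Psi M (C t * rodrigues (φ t) u))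
      (-((M * C' * rodrigues (φ x) u).trace +
        φ' * (M * (C x * rodrigues (φ x) u) * hat u).trace)) x := by
  have e : ∀ t, Psi M (C t * rodrigues (φ t) u) = M.trace - ((M * C t * 1).trace +
      Real.sin (φ t) * (M * C t * hat u).trace +
      (1 - Real.cos (φ t)) * (M * C t * (hat u * hat u)).trace) := by
    intro t
    simp [Psi, rodrigues, mul_sub, mul_add, mul_assoc, Matrix.trace_add, Matrix.trace_smul]
  simp only [e]
  have h1 := hasDerivAt_trace_mul_mul M 1 hC
  have h2 := hasDerivAt_trace_mul_mul M (hat u) hC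
  have h3 := hasDerivAt_trace_mul_mul M (hat u * hat u) hC
  have h := ((h1.add (hφ.sin.mul h2)).add ((hφ.cos.const_sub 1).mul h3)).const_sub M.trace
  refine h.congr_deriv ?_
  rw [← mul_assoc M, mul_assoc (M * C x), rodrigues_mul_hat _ hu]
  simp only [rodrigues, mul_add, mul_one, mul_assoc, Matrix.trace_add, Matrix.trace_smul,
    mul_smul_comm, smul_eq_mul]
  ring

theorem hasDerivAt_warpedV {M : Mat} {k : ℝ} {c : ℝ → SO3} {C' : Mat} {X : SO3} {u : ℕ → Vec}
    {q : ℕ} (hu : u q ⬝ᵥ u q = 1) (h0 : c 0 = X)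
    (hC : ∀ i j, HasDerivAt (fun t => (c t : Mat) i j) (C' i j) 0)
    (hlt : |k / (2 * lamMax (gMat M)) * Psi M X| < 1) :
    HasDerivAt (fun t => warpedV M k u (c t) q)
      (-((M * C' * rodrigues (warpAngle M k X) (u q)).trace +
        angleDeriv M k X C' * (M * warp M k u X q * hat (u q)).trace)) 0 := by
  have h := hasDerivAt_Psi_rodrigues (M := M) hu hC (hasDerivAt_warpAngle h0 hC hlt)
  simp only [h0] at h
  exact h

theorem hasDerivAt_mul_rodrigues (X : Mat) (w : Vec) (i j : Fin 3) :
    HasDerivAt (fun t => (X * rodrigues t w) i j) ((X * hat w) i j) 0 := by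
  have h1 : HasDerivAt Real.sin 1 0 := by simpa using Real.hasDerivAt_sin 0
  have h2 : HasDerivAt (fun t => 1 - Real.cos t) 0 0 := by
    simpa using (Real.hasDerivAt_cos 0).const_sub 1
  have h := ((h1.mul_const ((X * hat w) i j)).const_add (X i j)).add
    (h2.mul_const ((X * (hat w * hat w)) i j))
  simp only [one_mul, zero_mul, add_zero] at h
  refine h.congr_of_eventuallyEq (.of_forall fun t => ?_)
  simp [rodrigues, mul_add]

theorem skew_of_hasDerivAt {c : ℝ → SO3} {X : SO3} {C' : Mat} (h0 : c 0 = X)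
    (hC : ∀ i j, HasDerivAt (fun t => (c t : Mat) i j) (C' i j) 0) :
    ((X : Mat)ᵀ * C')ᵀ = -((X : Mat)ᵀ * C') := by
  have key : C'ᵀ * X + (X : Mat)ᵀ * C' = 0 := by
    ext i j
    have h : HasDerivAt (fun t => ((c t : Mat)ᵀ * (c t : Mat)) i j)
        ((C'ᵀ * X + (X : Mat)ᵀ * C') i j) 0 := by
      simp only [Matrix.add_apply, Matrix.mul_apply, Matrix.transpose_apply,
        ← Finset.sum_add_distrib]
      refine HasDerivAt.fun_sum fun l _ => ?_
      have := (hC l i).fun_mul (hC l j)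
      rwa [h0] at this
    have h' : HasDerivAt (fun t => ((c t : Mat)ᵀ * (c t : Mat)) i j) 0 0 := by
      simp only [(orthogonal_relations _).2.1]
      exact hasDerivAt_const _ _
    exact h.unique h'
  rw [Matrix.transpose_mul, Matrix.transpose_transpose]
  exact eq_neg_of_add_eq_zero_left key

theorem eq_zero_of_psi_eq_zero {S : Mat} (hS : Sᵀ = -S) (h : psi S = 0) : S = 0 := by
  have hs : ∀ i j, S j i = -S i j := fun i j => by
    have := congrFun (congrFun hS i) j
    simpa using this
  have e0 := congrFun h 0
  have e1 := congrFun h 1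
  have e2 := congrFun h 2
  simp [psi, vee, antisymPart] at e0 e1 e2
  ext i j
  have := hs 0 0; have := hs 1 1; have := hs 2 2; have := hs 0 1; have := hs 0 2; have := hs 1 2
  fin_cases i <;> fin_cases j <;> simp <;> linarith

/-- Where the warping is a local diffeomorphism, the critical points of the warped function are
the preimages of the critical points of `Ψ_M`. -/
theorem mem_crit_iff {M : Mat} {k : ℝ} {Q : Finset ℕ} {u : ℕ → Vec} {X : SO3} {q : ℕ}
    (hu : u q ⬝ᵥ u q = 1) (hlt : |k / (2 * lamMax (gMat M)) * Psi M X| < 1)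
    (hne : angleDeriv M k X (X * hat (u q)) ≠ -1) :
    (X, q) ∈ Crit Q (warpedV M k u) ↔ q ∈ Q ∧ (M * warp M k u X q).IsSymm := by
  set R := rodrigues (warpAngle M k X) (u q) with hR
  have hRR : R * Rᵀ = 1 := rodrigues_mul_transpose _ hu
  have hRR' : Rᵀ * R = 1 := mul_eq_one_comm.mp hRR
  constructor
  · rintro ⟨hq, W, ⟨⟨S, hS, hW⟩, hgrad⟩, hpsi⟩
    refine ⟨hq, ?_⟩
    simp only at hW hpsi hgrad hq
    rw [hW, ← mul_assoc, (orthogonal_relations X).2.1, one_mul] at hpsi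
    have hS0 := eq_zero_of_psi_eq_zero hS hpsi
    rw [hS0, mul_zero] at hW
    subst hW
    have key : ∀ w : Vec, w ⬝ᵥ w = 1 → (M * (X * hat w) * R).trace +
        angleDeriv M k X (X * hat w) * (M * warp M k u X q * hat (u q)).trace = 0 := by
      intro w hw
      let c : ℝ → SO3 := fun t => X * ⟨rodrigues t w, rodrigues_mem t hw⟩
      have hc0 : c 0 = X := by
        apply Subtype.ext
        simp [c, rodrigues]
      have hcd : ∀ i j, HasDerivAt (fun t => (c t : Mat) i j) (((X : Mat) * hat w) i j) 0 :=
        fun i j => hasDerivAt_mul_rodrigues X w i j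
      have h1 := hgrad c _ hc0 hcd
      have h2 := (hasDerivAt_warpedV hu hc0 hcd hlt).unique h1
      simp only [Matrix.transpose_zero, Matrix.zero_mul, Matrix.trace_zero, neg_eq_zero] at h2
      exact h2
    have hMXR : M * warp M k u X q = M * X * R := by rw [warp, mul_assoc]
    have hu0 : (M * warp M k u X q * hat (u q)).trace = 0 := by
      have h := key _ hu
      -- In the direction `w = u q` the warp rotation commutes with `hat (u q)`, so both terms of
      -- the derivative are multiples of the same trace, with total factor `1 + angleDeriv`.
      rw [mul_assoc M, mul_assoc (X : Mat), rodrigues_hat_comm, ← mul_assoc (X : Mat),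
        ← mul_assoc M] at h
      rw [show (X : Mat) * rodrigues (warpAngle M k X) (u q) = warp M k u X q from rfl] at h
      have h' : (1 + angleDeriv M k X (X * hat (u q))) *
        (M * warp M k u X q * hat (u q)).trace = 0 := by linarith
      rcases mul_eq_zero.mp h' with h'' | h''
      · exact absurd (by linarith) hne
      · exact h''
    -- With the angular term gone, all directions together say that `R M X` is symmetric.
    -- Conjugation by `R` carries this to `M X R`.
    have hsym : (R * (M * X)).IsSymm := by
      apply isSymm_of_trace_mul_hat
      intro w hw
      have h := key w hw
      rw [hu0, mul_zero, add_zero, Matrix.trace_mul_comm, ← mul_assoc M, ← mul_assoc] at h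
      exact h
    have : M * warp M k u X q = Rᵀ * (R * (M * X)) * R := by
      rw [hMXR, ← mul_assoc Rᵀ, hRR', one_mul]
    rw [this, Matrix.IsSymm, Matrix.transpose_mul, Matrix.transpose_mul, hsym.eq,
      Matrix.transpose_transpose]
    simp only [mul_assoc]
  · rintro ⟨hq, hsym⟩
    refine ⟨hq, 0, ⟨⟨0, by simp, by simp⟩, ?_⟩, ?_⟩
    · intro c C' h0 hC
      have h := hasDerivAt_warpedV (M := M) (k := k) hu h0 hC hlt
      refine h.congr_deriv ?_
      have hskew := skew_of_hasDerivAt h0 hC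
      have h1 := trace_symm_mul_skew hsym (hat_transpose (u q))
      have h2 : (M * C' * R).trace = 0 := by
        have hC' : C' = X * ((X : Mat)ᵀ * C') := by
          rw [← mul_assoc, (orthogonal_relations X).1, one_mul]
        set S := (X : Mat)ᵀ * C'
        have e : M * C' * R = (M * warp M k u X q) * (Rᵀ * S * R) := by
          rw [hC', warp, ← hR]
          have : R * (Rᵀ * (S * R)) = S * R := by rw [← mul_assoc, hRR, one_mul]
          simp only [mul_assoc, this]
        rw [e]
        apply trace_symm_mul_skew hsym
        simp only [Matrix.transpose_mul, Matrix.transpose_transpose, hskew, mul_assoc,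
          Matrix.neg_mul, Matrix.mul_neg]
      rw [h1, h2]
      simp
    · simp [psi, vee, antisymPart]

/-! ### Matrices `M` for which `G` has a distinguished axis. -/

/-- The symmetric matrix `M` for which `tr(M) I - M = g I + h n nᵀ`, for a unit vector `n`. -/
def axisMat (g h : ℝ) (n : Vec) : Mat := ((g + h) / 2) • (1 : Mat) - h • vecMulVec n n

/-- The quadratic form of `g I + h n nᵀ`. -/
def axisForm (g h : ℝ) (n w : Vec) : ℝ := g * (w ⬝ᵥ w) + h * (w ⬝ᵥ n) ^ 2

theorem gMat_axisMat (g h : ℝ) {n : Vec} (hn : n ⬝ᵥ n = 1) :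
    gMat (axisMat g h n) = g • (1 : Mat) + h • vecMulVec n n := by
  have : (axisMat g h n).trace = 3 * ((g + h) / 2) - h := by
    simp [axisMat, Matrix.trace_sub, Matrix.trace_smul, hn]
    ring
  rw [gMat, this, axisMat]
  module

theorem gMat_axisMat_mulVec (g h : ℝ) {n : Vec} (hn : n ⬝ᵥ n = 1) (w : Vec) :
    gMat (axisMat g h n) *ᵥ w = g • w + (h * (w ⬝ᵥ n)) • n := by
  rw [gMat_axisMat g h hn, Matrix.add_mulVec, Matrix.smul_mulVec, Matrix.smul_mulVec,
    Matrix.one_mulVec, Matrix.vecMulVec_mulVec, dotProduct_comm n w]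
  ext i
  simp
  ring

theorem spectrum_gMat_axisMat {g h : ℝ} {n m : Vec} (hn : n ⬝ᵥ n = 1) (hm : m ⬝ᵥ m = 1)
    (hmn : m ⬝ᵥ n = 0) : spectrum ℝ (gMat (axisMat g h n)) = {g, g + h} := by
  ext t
  rw [← Matrix.spectrum_toLin', ← Module.End.hasEigenvalue_iff_mem_spectrum]
  constructor
  · intro ht
    obtain ⟨w, hw⟩ := ht.exists_hasEigenvector
    have h1 := hw.apply_eq_smul
    rw [Matrix.toLin'_apply, gMat_axisMat_mulVec g h hn] at h1
    have h2 := congrArg (fun x => x ⬝ᵥ n) h1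
    simp only [add_dotProduct, smul_dotProduct, hn, smul_eq_mul] at h2
    by_contra hc
    simp only [Set.mem_insert_iff, Set.mem_singleton_iff, not_or] at hc
    have h3 : w ⬝ᵥ n = 0 := by
      have : (g + h - t) * (w ⬝ᵥ n) = 0 := by linarith
      rcases mul_eq_zero.mp this with h' | h'
      · exact absurd (by linarith) hc.2
      · exact h'
    rw [h3] at h1
    have h4 : (g - t) • w = 0 := by
      rw [sub_smul, ← h1]; simp
    rcases smul_eq_zero.mp h4 with h' | h'
    · exact hc.1 (by linarith)
    · exact hw.2 h'
  · have hne : ∀ x : Vec, x ⬝ᵥ x = 1 → x ≠ 0 := by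
      rintro x hx rfl
      simp at hx
    rintro (rfl | rfl)
    · refine Module.End.hasEigenvalue_of_hasEigenvector (x := m)
        (Module.End.hasEigenvector_iff.mpr ⟨Module.End.mem_eigenspace_iff.mpr ?_, hne m hm⟩)
      rw [Matrix.toLin'_apply, gMat_axisMat_mulVec _ h hn, hmn]
      simp
    · refine Module.End.hasEigenvalue_of_hasEigenvector (x := n)
        (Module.End.hasEigenvector_iff.mpr ⟨Module.End.mem_eigenspace_iff.mpr ?_, hne n hn⟩)
      rw [Matrix.toLin'_apply, gMat_axisMat_mulVec _ h hn, hn]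
      module

theorem lamMax_gMat_axisMat {g h : ℝ} (hh : 0 ≤ h) {n m : Vec} (hn : n ⬝ᵥ n = 1)
    (hm : m ⬝ᵥ m = 1) (hmn : m ⬝ᵥ n = 0) : lamMax (gMat (axisMat g h n)) = g + h := by
  rw [lamMax, spectrum_gMat_axisMat hn hm hmn, csSup_pair]
  exact sup_eq_right.mpr (by linarith)

theorem lamMin_gMat_axisMat {g h : ℝ} (hh : 0 ≤ h) {n m : Vec} (hn : n ⬝ᵥ n = 1)
    (hm : m ⬝ᵥ m = 1) (hmn : m ⬝ᵥ n = 0) : lamMin (gMat (axisMat g h n)) = g := by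
  rw [lamMin, spectrum_gMat_axisMat hn hm hmn, csInf_pair]
  exact inf_eq_left.mpr (by linarith)

theorem lagrange_identity (x y : Vec) :
    (x ⬝ᵥ y) ^ 2 + (x ⨯₃ y) ⬝ᵥ (x ⨯₃ y) = (x ⬝ᵥ x) * (y ⬝ᵥ y) := by
  simp only [dot_eq, cross_zero, cross_one, cross_two]
  ring

theorem dot_self_nonneg (x : Vec) : 0 ≤ x ⬝ᵥ x := by
  rw [dot_eq]
  nlinarith [mul_self_nonneg (x 0), mul_self_nonneg (x 1), mul_self_nonneg (x 2)]

theorem axisForm_le {g h : ℝ} (hh : 0 ≤ h) {n : Vec} (hn : n ⬝ᵥ n = 1) (w : Vec) :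
    axisForm g h n w ≤ (g + h) * (w ⬝ᵥ w) := by
  have h1 := lagrange_identity w n
  rw [hn, mul_one] at h1
  have h2 := dot_self_nonneg (w ⨯₃ n)
  rw [axisForm]
  nlinarith

theorem le_axisForm (g : ℝ) {h : ℝ} (hh : 0 ≤ h) (n w : Vec) :
    g * (w ⬝ᵥ w) ≤ axisForm g h n w := by
  rw [axisForm]
  nlinarith [mul_nonneg hh (sq_nonneg (w ⬝ᵥ n))]

theorem axisForm_nonneg {g h : ℝ} (hg : 0 < g) (hh : 0 ≤ h) (n w : Vec) : 0 ≤ axisForm g h n w :=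
  (mul_nonneg hg.le (dot_self_nonneg w)).trans (le_axisForm g hh n w)

theorem eq_zero_of_axisForm_eq_zero {g h : ℝ} (hg : 0 < g) (hh : 0 ≤ h) {n w : Vec}
    (hw : axisForm g h n w = 0) : w = 0 := by
  have h1 := le_axisForm g hh n w
  have h2 := dot_self_nonneg w
  rw [← dotProduct_self_eq_zero]
  nlinarith

theorem axisForm_smul (g h : ℝ) (n w : Vec) (t : ℝ) :
    axisForm g h n (t • w) = t ^ 2 * axisForm g h n w := by
  simp only [axisForm, smul_dotProduct, dotProduct_smul, smul_eq_mul]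
  ring

theorem Psi_quat (g h : ℝ) {n : Vec} (hn : n ⬝ᵥ n = 1) (η : ℝ) (e : Vec) :
    Psi (axisMat g h n) (quat η e) = 2 * axisForm g h n e := by
  rw [quat_eq, axisForm]
  simp only [dot_eq] at *
  simp [Psi, axisMat, Matrix.trace, Fin.sum_univ_three, Matrix.mul_apply, vecMulVec_apply,
    Matrix.one_apply]
  linear_combination (-2 * h * (e 0 ^ 2 + e 1 ^ 2 + e 2 ^ 2)) * hn

/-- The vector paired with `w` is `η G e - e × G e`, since the multiple of `e` in `G e` drops out of
the cross product. -/
theorem trace_axisMat_quat_hat (g h : ℝ) {n : Vec} (hn : n ⬝ᵥ n = 1) (η : ℝ) (e w : Vec) :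
    (axisMat g h n * quat η e * hat w).trace =
      -2 * (w ⬝ᵥ (η • (g • e + (h * (e ⬝ᵥ n)) • n) - (h * (e ⬝ᵥ n)) • (e ⨯₃ n))) := by
  rw [trace_mul_hat, quat_eq]
  simp only [dot_eq, Pi.sub_apply, Pi.add_apply, Pi.smul_apply, smul_eq_mul, cross_zero, cross_one,
    cross_two] at *
  simp [axisMat, Fin.sum_univ_three, Matrix.mul_apply, vecMulVec_apply, Matrix.one_apply]
  linear_combination (2 * h * η * (w 0 * e 0 + w 1 * e 1 + w 2 * e 2)) * hn

/-- Pairing `η G e - e × G e` with `e` leaves `η eᵀGe`, which forces `η = 0` unless `e = 0`. The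
remaining condition `e × G e = 0` says that `e` is an eigenvector of `G`. -/
theorem isSymm_axisMat_mul_quat {g h : ℝ} (hg : 0 < g) (hh : 0 ≤ h) {n : Vec} (hn : n ⬝ᵥ n = 1)
    {η : ℝ} {e : Vec} (hsymm : (axisMat g h n * quat η e).IsSymm) :
    e = 0 ∨ (η = 0 ∧ (h * (e ⬝ᵥ n)) • (e ⨯₃ n) = 0) := by
  rw [isSymm_iff_trace_mul_hat] at hsymm
  by_cases he : e = 0
  · exact .inl he
  right
  have hη : η = 0 := by
    have h1 := hsymm e
    rw [trace_axisMat_quat_hat g h hn] at h1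
    have h2 : η * axisForm g h n e = 0 := by
      simp only [dotProduct_sub, dotProduct_smul, dotProduct_add, dot_self_cross, smul_eq_mul] at h1
      rw [axisForm]
      linarith
    rcases mul_eq_zero.mp h2 with h3 | h3
    · exact h3
    · exact absurd (eq_zero_of_axisForm_eq_zero hg hh h3) he
  refine ⟨hη, ?_⟩
  have h1 := hsymm ((h * (e ⬝ᵥ n)) • (e ⨯₃ n))
  rw [trace_axisMat_quat_hat g h hn, hη, zero_smul, zero_sub, dotProduct_neg] at h1
  rw [← dotProduct_self_eq_zero]
  linarith

theorem isSymm_axisMat_mul_quat_zero {g h : ℝ} {n : Vec} (hn : n ⬝ᵥ n = 1)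
    {e : Vec} (he : (h * (e ⬝ᵥ n)) • (e ⨯₃ n) = 0) : (axisMat g h n * quat 0 e).IsSymm := by
  rw [isSymm_iff_trace_mul_hat]
  intro w
  rw [trace_axisMat_quat_hat g h hn, he]
  simp

/-- By Cauchy-Schwarz the left side is at most the squared norm of `η G e - e × G e`. That norm is
`eᵀG²e - (eᵀGe)²`, and `G² ≤ (g + h) G`. -/
theorem slope_bound {g h : ℝ} (hg : 0 < g) (hh : 0 ≤ h) {n : Vec} (hn : n ⬝ᵥ n = 1) {η : ℝ}
    {e w : Vec} (hw : w ⬝ᵥ w = 1) (he : η ^ 2 + e ⬝ᵥ e = 1) :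
    (w ⬝ᵥ (η • (g • e + (h * (e ⬝ᵥ n)) • n) - (h * (e ⬝ᵥ n)) • (e ⨯₃ n))) ^ 2 ≤
      (g + h) * axisForm g h n e - axisForm g h n e ^ 2 := by
  set z := η • (g • e + (h * (e ⬝ᵥ n)) • n) - (h * (e ⬝ᵥ n)) • (e ⨯₃ n) with hz
  have h1 := lagrange_identity w z
  rw [hw, one_mul] at h1
  have h2 := dot_self_nonneg (w ⨯₃ z)
  have h3 : z ⬝ᵥ z = g ^ 2 * (e ⬝ᵥ e) + (2 * g * h + h ^ 2) * (e ⬝ᵥ n) ^ 2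
      - axisForm g h n e ^ 2 := by
    have h4 : e ⬝ᵥ (e ⨯₃ n) = 0 := dot_self_cross e n
    have h5 : n ⬝ᵥ (e ⨯₃ n) = 0 := dot_cross_self e n
    have h6 := lagrange_identity e n
    rw [hn, mul_one] at h6
    rw [hz]
    simp only [sub_dotProduct, dotProduct_sub, dotProduct_smul, smul_dotProduct, dotProduct_add,
      add_dotProduct, smul_eq_mul, h4, h5, hn, dotProduct_comm (e ⨯₃ n), dotProduct_comm n e,
      axisForm]
    linear_combination (g ^ 2 * (e ⬝ᵥ e) + (2 * g * h + h ^ 2) * (e ⬝ᵥ n) ^ 2) * he +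
      (h * (e ⬝ᵥ n)) ^ 2 * h6
  have h7 : (e ⬝ᵥ n) ^ 2 ≤ e ⬝ᵥ e := by
    have h8 := lagrange_identity e n
    have h9 := dot_self_nonneg (e ⨯₃ n)
    rw [hn, mul_one] at h8
    linarith
  have h8 : g ^ 2 * (e ⬝ᵥ e) + (2 * g * h + h ^ 2) * (e ⬝ᵥ n) ^ 2 ≤
      (g + h) * axisForm g h n e := by
    rw [axisForm]
    nlinarith [mul_le_mul_of_nonneg_left h7 (mul_nonneg hg.le hh)]
  linarith

/-! ### Critical configurations and gains. -/

/-- The vector part of the quaternion product `(0, e) (c, -s u)`. -/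
def unwarpVec (u e : Vec) (s c : ℝ) : Vec := c • e - s • (e ⨯₃ u)

/-- The vector part of the quaternion product `(0, e) (c, -s u) (c, s p)`. -/
def rewarpVec (u e : Vec) (s c : ℝ) (p : Vec) : Vec :=
  (s * (e ⬝ᵥ u)) • (s • p) + c • unwarpVec u e s c + unwarpVec u e s c ⨯₃ (s • p)

/-- The decrease of the warped function when the warping direction is changed from `u` to `p` at
the critical point that is warped to the half-turn about `e`. -/
def gain (g h : ℝ) (n u e : Vec) (s c : ℝ) (p : Vec) : ℝ :=
  2 * axisForm g h n e - 2 * axisForm g h n (rewarpVec u e s c p)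

/-- The half-turn about `e`, rotated back by the angle `2 arcsin s` about `u`, is a critical point
of the function warped with gain `k` and direction `u`; here `c = √(1 - s²)`. -/
structure IsCritConfig (g h k : ℝ) (n u e : Vec) (s c : ℝ) : Prop where
  unit : e ⬝ᵥ e = 1
  eigen : (h * (e ⬝ᵥ n)) • (e ⨯₃ n) = 0
  s_nonneg : 0 ≤ s
  c_nonneg : 0 ≤ c
  sq_add_sq : s ^ 2 + c ^ 2 = 1
  fixed : (g + h) * s = k * axisForm g h n (unwarpVec u e s c)

theorem smul_norm {s c : ℝ} (hsc : s ^ 2 + c ^ 2 = 1) {u : Vec} (hu : u ⬝ᵥ u = 1) :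
    c ^ 2 + (s • u) ⬝ᵥ (s • u) = 1 := by
  rw [smul_dotProduct, dotProduct_smul, hu]
  simp only [smul_eq_mul]
  linarith

theorem unwarp_eq {u e : Vec} (hu : u ⬝ᵥ u = 1) (he : e ⬝ᵥ e = 1) {s c : ℝ}
    (hsc : s ^ 2 + c ^ 2 = 1) :
    (s * (e ⬝ᵥ u)) ^ 2 + unwarpVec u e s c ⬝ᵥ unwarpVec u e s c = 1 ∧
      quat 0 e * quat c (-(s • u)) = quat (s * (e ⬝ᵥ u)) (unwarpVec u e s c) := by
  have h1 : (0 : ℝ) ^ 2 + e ⬝ᵥ e = 1 := by rw [he]; norm_num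
  have h2 : c ^ 2 + (-(s • u)) ⬝ᵥ (-(s • u)) = 1 := by simpa using smul_norm hsc hu
  have h3 : (0 : ℝ) * c - e ⬝ᵥ (-(s • u)) = s * (e ⬝ᵥ u) := by simp
  have h4 : (0 : ℝ) • (-(s • u)) + c • e + e ⨯₃ (-(s • u)) = unwarpVec u e s c := by
    rw [unwarpVec]
    simp [sub_eq_add_neg]
  have h5 := quat_norm_mul h1 h2
  have h6 := quat_mul h1 h2
  rw [h3, h4] at h5 h6
  exact ⟨h5, h6⟩

section

variable {g h k : ℝ} {n m : Vec}

theorem warpAngle_axisMat (hh : 0 ≤ h) (hn : n ⬝ᵥ n = 1) (hm : m ⬝ᵥ m = 1)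
    (hmn : m ⬝ᵥ n = 0) {X : SO3} {η : ℝ} {e : Vec} (hX : (X : Mat) = quat η e) :
    k / (2 * lamMax (gMat (axisMat g h n))) * Psi (axisMat g h n) X =
      k / (g + h) * axisForm g h n e := by
  rw [lamMax_gMat_axisMat hh hn hm hmn, hX, Psi_quat g h hn]
  field_simp

/-- The bounded quantity is `sin(θ/2)`; for `k < 1` it keeps the arcsine away from the endpoints
where it is not differentiable. -/
theorem gain_mul_axisForm_bounds (hg : 0 < g) (hh : 0 ≤ h) (hn : n ⬝ᵥ n = 1) (hk : 0 < k)
    {η : ℝ} {e : Vec} (he : η ^ 2 + e ⬝ᵥ e = 1) :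
    0 ≤ k / (g + h) * axisForm g h n e ∧ k / (g + h) * axisForm g h n e ≤ k := by
  have h1 := axisForm_nonneg hg hh n e
  have h2 := axisForm_le (g := g) hh hn e
  have h3 : 0 < g + h := by linarith
  refine ⟨by positivity, ?_⟩
  rw [div_mul_eq_mul_div, div_le_iff₀ h3]
  have : (g + h) * (e ⬝ᵥ e) ≤ g + h := by nlinarith [sq_nonneg η]
  nlinarith

theorem rodrigues_two_arcsin {s c : ℝ} (hs : -1 ≤ s) (hs' : s ≤ 1) (hc : 0 ≤ c)
    (hsc : s ^ 2 + c ^ 2 = 1) (u : Vec) : rodrigues (2 * Real.arcsin s) u = quat c (s • u) := by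
  rw [rodrigues_eq_quat, mul_div_cancel_left₀ _ two_ne_zero, Real.sin_arcsin hs hs',
    Real.cos_arcsin, show 1 - s ^ 2 = c ^ 2 by linarith, Real.sqrt_sq hc]

/-- The gain condition makes the warping a local diffeomorphism. -/
theorem angleDeriv_ne (hg : 0 < g) (hh : 0 ≤ h) (hn : n ⬝ᵥ n = 1) (hm : m ⬝ᵥ m = 1)
    (hmn : m ⬝ᵥ n = 0) (hk : 0 < k) (hk2 : k ^ 2 < 1 / 2) {X : SO3} {w : Vec} (hw : w ⬝ᵥ w = 1) :
    angleDeriv (axisMat g h n) k X (X * hat w) ≠ -1 := by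
  obtain ⟨η, e, he, hX⟩ := exists_quat X
  intro hc
  rw [angleDeriv, warpAngle_axisMat hh hn hm hmn hX, lamMax_gMat_axisMat hh hn hm hmn,
    ← mul_assoc (axisMat g h n), hX, trace_axisMat_quat_hat g h hn] at hc
  have hb := slope_bound hg hh hn hw he
  obtain ⟨hb1, hb2⟩ := gain_mul_axisForm_bounds hg hh hn hk he
  set T := w ⬝ᵥ (η • (g • e + (h * (e ⬝ᵥ n)) • n) - (h * (e ⬝ᵥ n)) • (e ⨯₃ n))
  set F := axisForm g h n e
  set σ := k / (g + h) * F with hσ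
  have hL : 0 < g + h := by linarith
  have h1 : 0 < 1 - σ ^ 2 := by nlinarith
  have h2 : √(1 - σ ^ 2) ^ 2 = 1 - σ ^ 2 := Real.sq_sqrt h1.le
  have h3 := Real.sqrt_pos.mpr h1
  set r := √(1 - σ ^ 2)
  have h4 : 2 * k * T = -(r * (g + h)) := by
    field_simp at hc
    linarith
  have h5 : σ * (g + h) = k * F := by rw [hσ]; field_simp
  have h6 : 4 * k ^ 2 * T ^ 2 = (g + h) ^ 2 - k ^ 2 * F ^ 2 := by
    have h7 : (2 * k * T) ^ 2 = (r * (g + h)) ^ 2 := by rw [h4]; ring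
    have h8 : (r * (g + h)) ^ 2 = (g + h) ^ 2 - (σ * (g + h)) ^ 2 := by rw [mul_pow, h2]; ring
    rw [h5] at h8
    linarith
  -- The slope bound gives `4T² + F² ≤ 4(g + h)F - 3F²`, a quadratic in `F` maximal at `F = 2(g +
  -- h)/3`. A derivative equal to `-1` would make the left side `(g + h)²`, hence `k² ≥ 3/4`.
  have h7 : k ^ 2 * (4 * T ^ 2 + F ^ 2) ≤ k ^ 2 * (4 / 3 * (g + h) ^ 2) := by
    apply mul_le_mul_of_nonneg_left _ (sq_nonneg k)
    nlinarith [sq_nonneg (3 * F - 2 * (g + h))]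
  have h8 : k ^ 2 * (g + h) ^ 2 ≤ 1 / 2 * (g + h) ^ 2 :=
    mul_le_mul_of_nonneg_right hk2.le (sq_nonneg _)
  have h9 : 0 < (g + h) ^ 2 := by positivity
  linarith

theorem warpedV_axisMat (hg : 0 < g) (hh : 0 ≤ h) (hn : n ⬝ᵥ n = 1) (hm : m ⬝ᵥ m = 1)
    (hmn : m ⬝ᵥ n = 0) {X : SO3} {u : ℕ → Vec} {p : ℕ} (hp : u p ⬝ᵥ u p = 1) {η : ℝ}
    {e : Vec} (he : η ^ 2 + e ⬝ᵥ e = 1) (hX : (X : Mat) = quat η e) {s c : ℝ} (hs : 0 ≤ s)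
    (hc : 0 ≤ c) (hsc : s ^ 2 + c ^ 2 = 1) (hfix : (g + h) * s = k * axisForm g h n e) :
    warp (axisMat g h n) k u X p = quat η e * quat c (s • u p) ∧
    warpedV (axisMat g h n) k u X p =
      2 * axisForm g h n (η • (s • u p) + c • e + e ⨯₃ (s • u p)) := by
  have hL : 0 < g + h := by linarith
  have h1 : k / (g + h) * axisForm g h n e = s := by
    field_simp
    linarith
  have h2 : warp (axisMat g h n) k u X p = quat η e * quat c (s • u p) := by
    rw [warp, warpAngle, warpAngle_axisMat hh hn hm hmn hX, h1, hX,
      rodrigues_two_arcsin (by linarith) (by nlinarith) hc hsc]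
  refine ⟨h2, ?_⟩
  rw [warpedV, h2, quat_mul he (smul_norm hsc hp), Psi_quat g h hn]

theorem isGreatest_sub_iff {N : Set Vec} (hN : N.Finite) (hN' : N.Nonempty) (A r : ℝ)
    (f : Vec → ℝ) : IsGreatest ((fun w => A - f w) '' N) r ↔ r = A - sInf (f '' N) := by
  have h1 : IsGreatest ((fun w => A - f w) '' N) (A - sInf (f '' N)) := by
    obtain ⟨w, hw, hw'⟩ := (hN'.image f).csInf_mem (hN.image f)
    refine ⟨⟨w, hw, by simp only [hw']⟩, ?_⟩
    rintro _ ⟨x, hx, rfl⟩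
    have := csInf_le (hN.image f).bddBelow (Set.mem_image_of_mem f hx)
    simp only
    linarith
  exact ⟨fun h => h.unique h1, fun h => h ▸ h1⟩

/-- The gap values, in terms of the axes of the half-turns to which the critical points are
warped. -/
theorem mem_gapValues_iff (hg : 0 < g) (hh : 0 ≤ h) (hn : n ⬝ᵥ n = 1) (hm : m ⬝ᵥ m = 1)
    (hmn : m ⬝ᵥ n = 0) (hk : 0 < k) (hk2 : k ^ 2 < 1 / 2) {Q : Finset ℕ} {u : ℕ → Vec}
    {Qs : ℕ → Finset ℕ} {q : ℕ} {N : Set Vec} (hq : q ∈ Q) (hu : ∀ p ∈ Q, u p ⬝ᵥ u p = 1)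
    (hQs : Qs q ⊆ Q) (hN : u '' (Qs q : Set ℕ) = N) (hne : N.Nonempty) (r : ℝ) :
    r ∈ gapValues Q (warpedV (axisMat g h n) k u) Qs q ↔
      ∃ e s c, IsCritConfig g h k n (u q) e s c ∧ IsGreatest (gain g h n (u q) e s c '' N) r := by
  have hL : 0 < g + h := by linarith
  have hlt : ∀ X : SO3,
      |k / (2 * lamMax (gMat (axisMat g h n))) * Psi (axisMat g h n) X| < 1 := by
    intro X
    obtain ⟨η, e, he, hX⟩ := exists_quat X
    obtain ⟨h1, h2⟩ := gain_mul_axisForm_bounds hg hh hn hk he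
    rw [warpAngle_axisMat hh hn hm hmn hX, abs_of_nonneg h1]
    nlinarith
  have hcrit : ∀ X : SO3, (X, q) ∈ Crit Q (warpedV (axisMat g h n) k u) ↔
      (axisMat g h n * warp (axisMat g h n) k u X q).IsSymm := fun X => by
    rw [mem_crit_iff (hu q hq) (hlt X) (angleDeriv_ne hg hh hn hm hmn hk hk2 (hu q hq))]
    exact and_iff_right hq
  have hfin : N.Finite := hN ▸ (Qs q).finite_toSet.image u
  have hgap : ∀ (X : SO3) (e : Vec) (s c : ℝ), IsCritConfig g h k n (u q) e s c →
      (X : Mat) = quat 0 e * quat c (-(s • u q)) →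
      warp (axisMat g h n) k u X q = quat 0 e ∧
      (r = refinedGap (warpedV (axisMat g h n) k u) Qs X q ↔
        IsGreatest (gain g h n (u q) e s c '' N) r) := by
    intro X e s c hcfg hX
    obtain ⟨h1, h2⟩ := unwarp_eq (hu q hq) hcfg.unit hcfg.sq_add_sq
    have hV := fun p (hp : p ∈ Q) => warpedV_axisMat (k := k) hg hh hn hm hmn (hu p hp) h1
      (hX.trans h2) hcfg.s_nonneg hcfg.c_nonneg hcfg.sq_add_sq hcfg.fixed
    have hw : warp (axisMat g h n) k u X q = quat 0 e := by
      rw [(hV q hq).1, ← h2, mul_assoc, ← quat_transpose, mul_eq_one_comm.mp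
        (quat_mul_transpose (smul_norm hcfg.sq_add_sq (hu q hq))), mul_one]
    refine ⟨hw, ?_⟩
    have hVq : warpedV (axisMat g h n) k u X q = 2 * axisForm g h n e := by
      rw [warpedV, hw, Psi_quat g h hn]
    have himg : (fun p => warpedV (axisMat g h n) k u X p) '' (Qs q : Set ℕ) =
        (fun w => 2 * axisForm g h n (rewarpVec (u q) e s c w)) '' N := by
      rw [← hN, Set.image_image]
      exact Set.image_congr fun p hp => (hV p (hQs hp)).2
    rw [refinedGap, hVq, himg]
    exact (isGreatest_sub_iff hfin hne _ r _).symm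
  constructor
  · rintro ⟨⟨X, q'⟩, ⟨hX, hX'⟩, hq', hr⟩
    simp only at hq' hr
    subst hq'
    have hX1 : X ≠ 1 := fun h1 => hX' ⟨h1, hq⟩
    rw [hcrit] at hX
    obtain ⟨η₀, e₀, he₀, hXq⟩ := exists_quat X
    obtain ⟨hs, hsk⟩ := gain_mul_axisForm_bounds hg hh hn hk he₀
    set s := k / (g + h) * axisForm g h n e₀ with hs_def
    have hfix : (g + h) * s = k * axisForm g h n e₀ := by rw [hs_def]; field_simp
    have hs1 : s ^ 2 < 1 := by nlinarith
    set c := √(1 - s ^ 2) with hc_def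
    have hc : 0 ≤ c := Real.sqrt_nonneg _
    have hsc : s ^ 2 + c ^ 2 = 1 := by rw [hc_def, Real.sq_sqrt (by linarith)]; ring
    have hu' := hu q' hq
    obtain ⟨hw, -⟩ := warpedV_axisMat (k := k) hg hh hn hm hmn hu' he₀ hXq hs hc hsc hfix
    have hnorm := quat_norm_mul he₀ (smul_norm hsc hu')
    have hw' := hw.trans (quat_mul he₀ (smul_norm hsc hu'))
    set η₁ := η₀ * c - e₀ ⬝ᵥ (s • u q')
    set e₁ := η₀ • (s • u q') + c • e₀ + e₀ ⨯₃ (s • u q')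
    have hback : (X : Mat) = quat η₁ e₁ * quat c (-(s • u q')) := by
      rw [← hw', hw, mul_assoc, ← quat_transpose, quat_mul_transpose (smul_norm hsc hu'), mul_one,
        hXq]
    have hfix' : (g + h) * s = k * (Psi (axisMat g h n) X / 2) := by
      rw [hXq, Psi_quat g h hn, hfix]; ring
    rw [hw'] at hX
    rcases isSymm_axisMat_mul_quat hg hh hn hX with he₁ | ⟨hη₁, he₁⟩
    -- A point warped to the identity is a rotation about `u` itself, so `s (g + h) = k s² uᵀGu ≤ k
    -- s² (g + h)`. As `k s < 1`, this leaves only `s = 0`, that is `X = I`.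
    · exfalso
      have hq1 : quat η₁ e₁ = 1 := by simp [he₁, quat_eq, ← Matrix.one_fin_three]
      rw [hq1, one_mul] at hback
      rw [hback, Psi_quat g h hn, show -(s • u q') = (-s) • u q' by simp, axisForm_smul] at hfix'
      have h1 := axisForm_le (g := g) hh hn (u q')
      rw [hu', mul_one] at h1
      have h2 : s = 0 := by
        by_contra hs0
        have hs' : 0 < s := lt_of_le_of_ne hs (Ne.symm hs0)
        have h3 : g + h = k * s * axisForm g h n (u q') := by
          apply mul_right_cancel₀ hs0
          linarith
        have h4 : k * s < 1 := by nlinarith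
        have h5 : k * s * axisForm g h n (u q') ≤ k * s * (g + h) :=
          mul_le_mul_of_nonneg_left h1 (by positivity)
        nlinarith
      apply hX1
      apply Subtype.ext
      rw [hback, h2]
      simp [quat_eq, ← Matrix.one_fin_three]
    · rw [hη₁] at hback hnorm
      have hunit : e₁ ⬝ᵥ e₁ = 1 := by simpa using hnorm
      obtain ⟨h1, h2⟩ := unwarp_eq hu' hunit hsc
      have hcfg : IsCritConfig g h k n (u q') e₁ s c := by
        refine ⟨hunit, he₁, hs, hc, hsc, ?_⟩
        rw [hfix', hback, h2, Psi_quat g h hn]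
        ring
      exact ⟨e₁, s, c, hcfg, (hgap X e₁ s c hcfg hback).2.mp hr⟩
  · rintro ⟨e, s, c, hcfg, hr⟩
    obtain ⟨h1, h2⟩ := unwarp_eq (hu q hq) hcfg.unit hcfg.sq_add_sq
    let X : SO3 := ⟨quat (s * (e ⬝ᵥ u q)) (unwarpVec (u q) e s c), quat_mem h1⟩
    obtain ⟨hw, hr'⟩ := hgap X e s c hcfg h2.symm
    refine ⟨(X, q), ⟨?_, ?_⟩, rfl, hr'.mpr hr⟩
    · rw [hcrit, hw]
      exact isSymm_axisMat_mul_quat_zero hn hcfg.eigen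
    -- At `X = I` the fixed-point equation would give `s = 0`, so no unwarping takes place and the
    -- half-turn axis would vanish.
    · rintro ⟨hX1, -⟩
      have hX1 : X = 1 := hX1
      have h3 : Psi (axisMat g h n) (X : Mat) = 0 := by
        rw [hX1]; simp [Psi]
      have h4 : Psi (axisMat g h n) (X : Mat) = _ := Psi_quat g h hn _ _
      have h5 := hcfg.fixed
      rw [show axisForm g h n (unwarpVec (u q) e s c) = 0 by linarith, mul_zero] at h5
      have h6 : s = 0 := by
        rcases mul_eq_zero.mp h5 with h' | h'
        · linarith
        · exact h'
      have h7 := eq_zero_of_axisForm_eq_zero hg hh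
        (show axisForm g h n (unwarpVec (u q) e s c) = 0 by linarith)
      have h8 := hcfg.sq_add_sq
      rw [h6] at h8
      rw [unwarpVec, h6, zero_smul, sub_zero] at h7
      have h9 := hcfg.unit
      rcases smul_eq_zero.mp h7 with h' | h'
      · rw [h'] at h8; norm_num at h8
      · rw [h'] at h9; simp at h9

end

/-! ### Compactness of the set of critical configurations. -/

theorem continuous_axisForm (g h : ℝ) (n : Vec) : Continuous (axisForm g h n) := by
  change Continuous fun w => axisForm g h n w
  simp only [axisForm, dot_eq]
  fun_prop

theorem continuous_unwarpVec (u : Vec) :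
    Continuous fun z : Vec × ℝ × ℝ => unwarpVec u z.1 z.2.1 z.2.2 := by
  simp only [unwarpVec, cross_apply]
  fun_prop

theorem continuous_gain (g h : ℝ) (n u p : Vec) :
    Continuous fun z : Vec × ℝ × ℝ => gain g h n u z.1 z.2.1 z.2.2 p := by
  have h1 := continuous_unwarpVec u
  have h2 : Continuous fun z : Vec × ℝ × ℝ => rewarpVec u z.1 z.2.1 z.2.2 p := by
    simp only [rewarpVec, cross_apply, dot_eq]
    fun_prop
  have h3 := continuous_axisForm g h n
  unfold gain
  fun_prop

/-- Keeping `c` as a coordinate with `s² + c² = 1` and `c ≥ 0` makes all conditions polynomial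
equations and weak inequalities, hence closed. The unit constraints confine them to a box. -/
theorem isCompact_critConfig (g h k : ℝ) (n u : Vec) :
    IsCompact {z : Vec × ℝ × ℝ | IsCritConfig g h k n u z.1 z.2.1 z.2.2} := by
  have h1 := (continuous_axisForm g h n).comp (continuous_unwarpVec u)
  have hset : {z : Vec × ℝ × ℝ | IsCritConfig g h k n u z.1 z.2.1 z.2.2} =
      {z | z.1 ⬝ᵥ z.1 = 1} ∩ ({z | (h * (z.1 ⬝ᵥ n)) • (z.1 ⨯₃ n) = 0} ∩ ({z | 0 ≤ z.2.1} ∩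
        ({z | 0 ≤ z.2.2} ∩ ({z | z.2.1 ^ 2 + z.2.2 ^ 2 = 1} ∩
        {z | (g + h) * z.2.1 = k * axisForm g h n (unwarpVec u z.1 z.2.1 z.2.2)})))) := by
    ext z
    exact ⟨fun ⟨a, b, c, d, e, f⟩ => ⟨a, b, c, d, e, f⟩,
      fun ⟨a, b, c, d, e, f⟩ => ⟨a, b, c, d, e, f⟩⟩
  have hclosed : IsClosed {z : Vec × ℝ × ℝ | IsCritConfig g h k n u z.1 z.2.1 z.2.2} := by
    rw [hset]
    refine IsClosed.inter (isClosed_eq ?_ (by fun_prop))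
      (IsClosed.inter (isClosed_eq ?_ (by fun_prop))
      (IsClosed.inter (isClosed_le (by fun_prop) (by fun_prop))
      (IsClosed.inter (isClosed_le (by fun_prop) (by fun_prop))
      (IsClosed.inter (isClosed_eq (by fun_prop) (by fun_prop))
      (isClosed_eq (by fun_prop) (h1.const_mul k))))))
    · simp only [dot_eq]; fun_prop
    · simp only [dot_eq, cross_apply]; fun_prop
  have hbox : IsCompact ((Set.univ.pi fun _ : Fin 3 => Set.Icc (-1 : ℝ) 1) ×ˢ
      (Set.Icc (0 : ℝ) 1 ×ˢ Set.Icc (0 : ℝ) 1)) :=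
    (isCompact_univ_pi fun _ => isCompact_Icc).prod (isCompact_Icc.prod isCompact_Icc)
  refine hbox.of_isClosed_subset hclosed ?_
  rintro ⟨e, s, c⟩ hz
  obtain ⟨h1, -, h2, h3, h4, -⟩ := hz
  simp only [dot_eq] at h1 h2 h3 h4
  refine ⟨fun i _ => ?_, ⟨h2, by nlinarith⟩, ⟨h3, by nlinarith⟩⟩
  have h5 : e i * e i ≤ 1 := by
    have := mul_self_nonneg (e 0); have := mul_self_nonneg (e 1); have := mul_self_nonneg (e 2)
    fin_cases i <;> simp <;> linarith
  constructor <;> simp <;> nlinarith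

/-- The smallest value of the largest gain is attained. -/
theorem isLeast_isGreatest_gain {g h k : ℝ} {n u : Vec} {N : Set Vec} (hfin : N.Finite)
    (hne : N.Nonempty) {S : Set ℝ} (hS : ∀ r, r ∈ S ↔
      ∃ e s c, IsCritConfig g h k n u e s c ∧ IsGreatest (gain g h n u e s c '' N) r)
    (hcfg : ∃ e s c, IsCritConfig g h k n u e s c) : IsLeast S (sInf S) := by
  obtain ⟨N, rfl⟩ := hfin.exists_finset_coe
  have hne' : N.Nonempty := hne
  have hg : ∀ z : Vec × ℝ × ℝ, IsGreatest (gain g h n u z.1 z.2.1 z.2.2 '' (N : Set Vec))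
      (N.sup' hne' fun p => gain g h n u z.1 z.2.1 z.2.2 p) := by
    intro z
    refine ⟨?_, ?_⟩
    · obtain ⟨p, hp, hp'⟩ := N.exists_mem_eq_sup' hne' fun p => gain g h n u z.1 z.2.1 z.2.2 p
      exact ⟨p, hp, hp'.symm⟩
    · rintro _ ⟨p, hp, rfl⟩
      exact N.le_sup' (fun p => gain g h n u z.1 z.2.1 z.2.2 p) hp
  have hcont : Continuous fun z : Vec × ℝ × ℝ =>
      N.sup' hne' fun p => gain g h n u z.1 z.2.1 z.2.2 p :=
    Continuous.finset_sup'_apply hne' fun p _ => continuous_gain g h n u p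
  have himg : S = (fun z : Vec × ℝ × ℝ => N.sup' hne' fun p => gain g h n u z.1 z.2.1 z.2.2 p) ''
      {z | IsCritConfig g h k n u z.1 z.2.1 z.2.2} := by
    ext r
    rw [hS]
    constructor
    · rintro ⟨e, s, c, h1, h2⟩
      exact ⟨(e, s, c), h1, (hg (e, s, c)).unique h2⟩
    · rintro ⟨⟨e, s, c⟩, h1, rfl⟩
      exact ⟨e, s, c, h1, hg (e, s, c)⟩
  have hcpt : IsCompact S := himg ▸ (isCompact_critConfig g h k n u).image hcont
  refine hcpt.isLeast_sInf ?_
  obtain ⟨e, s, c, h1⟩ := hcfg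
  rw [himg]
  exact ⟨_, (e, s, c), h1, rfl⟩

/-! ### Gains in coordinates. -/

theorem axisForm_unwarpVec (g h : ℝ) {n u e : Vec} (hu : u ⬝ᵥ u = 1) (he : e ⬝ᵥ e = 1) {s c : ℝ}
    (hsc : s ^ 2 + c ^ 2 = 1) : axisForm g h n (unwarpVec u e s c) =
      g * (1 - (s * (e ⬝ᵥ u)) ^ 2) + h * (c * (e ⬝ᵥ n) - s * ((e ⨯₃ u) ⬝ᵥ n)) ^ 2 := by
  have h1 := (unwarp_eq hu he hsc).1
  have h2 : unwarpVec u e s c ⬝ᵥ n = c * (e ⬝ᵥ n) - s * ((e ⨯₃ u) ⬝ᵥ n) := by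
    rw [unwarpVec, sub_dotProduct, smul_dotProduct, smul_dotProduct]
    rfl
  rw [axisForm, h2]
  linear_combination g * h1

/-- The rewarped quaternion has norm one, so the isotropic part `g` of `G` contributes only through
its squared scalar part. The part along `n` contributes the change of the squared `n`-component. -/
theorem gain_eq (g h : ℝ) {n u e p : Vec} (hu : u ⬝ᵥ u = 1) (he : e ⬝ᵥ e = 1) (hp : p ⬝ᵥ p = 1)
    {s c : ℝ} (hsc : s ^ 2 + c ^ 2 = 1) : gain g h n u e s c p =
      2 * (g * (s * c * (e ⬝ᵥ u - e ⬝ᵥ p) + s ^ 2 * ((e ⨯₃ u) ⬝ᵥ p)) ^ 2 +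
        h * ((e ⬝ᵥ n) ^ 2 - ((c ^ 2 + s ^ 2 * (u ⬝ᵥ p)) * (e ⬝ᵥ n) +
          s ^ 2 * ((e ⬝ᵥ u) * (p ⬝ᵥ n) - (e ⬝ᵥ p) * (u ⬝ᵥ n)) +
          c * s * ((e ⨯₃ p) ⬝ᵥ n - (e ⨯₃ u) ⬝ᵥ n)) ^ 2)) := by
  have h1 := quat_norm_mul (unwarp_eq hu he hsc).1 (smul_norm hsc hp)
  have h2 : s * (e ⬝ᵥ u) * c - unwarpVec u e s c ⬝ᵥ (s • p) =
      s * c * (e ⬝ᵥ u - e ⬝ᵥ p) + s ^ 2 * ((e ⨯₃ u) ⬝ᵥ p) := by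
    rw [unwarpVec, sub_dotProduct, smul_dotProduct, smul_dotProduct, dotProduct_smul,
      dotProduct_smul]
    simp only [smul_eq_mul]
    ring
  rw [h2] at h1
  have h3 : rewarpVec u e s c p ⬝ᵥ n = (c ^ 2 + s ^ 2 * (u ⬝ᵥ p)) * (e ⬝ᵥ n) +
          s ^ 2 * ((e ⬝ᵥ u) * (p ⬝ᵥ n) - (e ⬝ᵥ p) * (u ⬝ᵥ n)) +
          c * s * ((e ⨯₃ p) ⬝ᵥ n - (e ⨯₃ u) ⬝ᵥ n) := by
    simp only [rewarpVec, unwarpVec, dot_eq, Pi.sub_apply, Pi.add_apply, Pi.smul_apply,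
      smul_eq_mul, cross_zero, cross_one, cross_two]
    ring
  rw [← h3, gain, axisForm, axisForm, he]
  have h4 : rewarpVec u e s c p ⬝ᵥ rewarpVec u e s c p =
      1 - (s * c * (e ⬝ᵥ u - e ⬝ᵥ p) + s ^ 2 * ((e ⨯₃ u) ⬝ᵥ p)) ^ 2 := by
    rw [← h1]
    rw [rewarpVec]
    ring
  rw [h4]
  ring

/-- `w` has length one and is orthogonal to the unit vector `n`. -/
structure IsPlanar (n w : Vec) : Prop where
  axis_unit : n ⬝ᵥ n = 1
  unit : w ⬝ᵥ w = 1
  orth : w ⬝ᵥ n = 0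

theorem cross_unit {n w : Vec} (hw : IsPlanar n w) : (n ⨯₃ w) ⬝ᵥ (n ⨯₃ w) = 1 := by
  have h := lagrange_identity n w
  rw [hw.axis_unit, hw.unit, dotProduct_comm, hw.orth] at h
  linarith

/-- Parseval in the orthonormal frame `u, n × u, n`, with the squared triple product expanded as a
Gram determinant. -/
theorem coord_sq_sum {n u : Vec} (hu : IsPlanar n u) (e : Vec) :
    (e ⬝ᵥ u) ^ 2 + (e ⬝ᵥ (n ⨯₃ u)) ^ 2 + (e ⬝ᵥ n) ^ 2 = e ⬝ᵥ e := by
  have h1 : (e ⬝ᵥ (n ⨯₃ u)) ^ 2 = (e ⬝ᵥ e) * ((n ⬝ᵥ n) * (u ⬝ᵥ u) - (u ⬝ᵥ n) ^ 2) -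
      (e ⬝ᵥ u) ^ 2 * (n ⬝ᵥ n) - (e ⬝ᵥ n) ^ 2 * (u ⬝ᵥ u) +
      2 * (e ⬝ᵥ u) * (e ⬝ᵥ n) * (u ⬝ᵥ n) := by
    simp only [dot_eq, cross_zero, cross_one, cross_two]
    ring
  rw [h1, hu.axis_unit, hu.unit, hu.orth]
  ring

theorem cross_dot_axis {n u : Vec} (e : Vec) : (e ⨯₃ u) ⬝ᵥ n = -(e ⬝ᵥ (n ⨯₃ u)) := by
  simp only [dot_eq, cross_zero, cross_one, cross_two]
  ring

theorem axisForm_unwarpVec_planar (g h : ℝ) {n u e : Vec} (hu : IsPlanar n u)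
    (he : e ⬝ᵥ e = 1) {s c : ℝ} (hsc : s ^ 2 + c ^ 2 = 1) :
    axisForm g h n (unwarpVec u e s c) =
      g * (1 - (s * (e ⬝ᵥ u)) ^ 2) + h * (c * (e ⬝ᵥ n) + s * (e ⬝ᵥ (n ⨯₃ u))) ^ 2 := by
  rw [axisForm_unwarpVec g h hu.unit he hsc, cross_dot_axis]
  ring

theorem gain_planar (g h : ℝ) {n u e : Vec} (hu : IsPlanar n u) (he : e ⬝ᵥ e = 1) {s c : ℝ}
    (hsc : s ^ 2 + c ^ 2 = 1) {κ τ : ℝ} (hκ : κ ^ 2 + τ ^ 2 = 1) :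
    gain g h n u e s c (κ • u + τ • (n ⨯₃ u)) =
      2 * (g * (s * c * ((1 - κ) * (e ⬝ᵥ u) - τ * (e ⬝ᵥ (n ⨯₃ u))) + s ^ 2 * τ * (e ⬝ᵥ n)) ^ 2 +
        h * ((e ⬝ᵥ n) ^ 2 - ((c ^ 2 + s ^ 2 * κ) * (e ⬝ᵥ n) +
          c * s * (τ * (e ⬝ᵥ u) + (1 - κ) * (e ⬝ᵥ (n ⨯₃ u)))) ^ 2)) := by
  have hua : u ⬝ᵥ (n ⨯₃ u) = 0 := dot_cross_self n u
  have hna : (n ⨯₃ u) ⬝ᵥ n = 0 := by rw [dotProduct_comm, dot_self_cross]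
  have hp : (κ • u + τ • (n ⨯₃ u)) ⬝ᵥ (κ • u + τ • (n ⨯₃ u)) = 1 := by
    simp only [dotProduct_add, add_dotProduct, dotProduct_smul, smul_dotProduct, hu.unit,
      cross_unit hu, hua, dotProduct_comm (n ⨯₃ u) u, smul_eq_mul]
    linarith
  rw [gain_eq g h hu.unit he hp hsc]
  have h1 : (e ⨯₃ u) ⬝ᵥ (n ⨯₃ u) = e ⬝ᵥ n := by
    rw [cross_dot_cross, hu.unit, dotProduct_comm u n, dotProduct_comm n u, hu.orth]
    ring
  have h2 : (e ⨯₃ (n ⨯₃ u)) ⬝ᵥ n = e ⬝ᵥ u := by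
    have : (e ⨯₃ (n ⨯₃ u)) ⬝ᵥ n = (e ⬝ᵥ u) * (n ⬝ᵥ n) - (e ⬝ᵥ n) * (u ⬝ᵥ n) := by
      simp only [dot_eq, cross_zero, cross_one, cross_two]
      ring
    rw [this, hu.axis_unit, hu.orth]
    ring
  have h3 : (e ⨯₃ u) ⬝ᵥ u = 0 := by rw [dotProduct_comm, dot_cross_self]
  simp only [dotProduct_add, add_dotProduct, dotProduct_smul, smul_dotProduct, hu.unit, hua, hna,
    hu.orth, map_add, map_smul, h1, h2, h3, cross_dot_axis, smul_eq_mul]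
  ring

/-- For `h > 0` the eigenspaces of `G` are the axis and its orthogonal plane. -/
theorem eigen_cases {h : ℝ} (hh : 0 < h) {n u e : Vec} (hu : IsPlanar n u) (he : e ⬝ᵥ e = 1)
    (heig : (h * (e ⬝ᵥ n)) • (e ⨯₃ n) = 0) :
    e ⬝ᵥ n = 0 ∨ ((e ⬝ᵥ n) ^ 2 = 1 ∧ e ⬝ᵥ u = 0 ∧ e ⬝ᵥ (n ⨯₃ u) = 0) := by
  rcases smul_eq_zero.mp heig with h1 | h1
  · rcases mul_eq_zero.mp h1 with h2 | h2
    · exact absurd h2 hh.ne'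
    · exact .inl h2
  · right
    have h2 := lagrange_identity e n
    rw [h1, he, hu.axis_unit] at h2
    have h3 := coord_sq_sum hu e
    have h4 : (e ⬝ᵥ n) ^ 2 = 1 := by simpa using h2
    refine ⟨h4, ?_, ?_⟩
    · apply pow_eq_zero_iff two_ne_zero |>.mp
      nlinarith [sq_nonneg (e ⬝ᵥ u), sq_nonneg (e ⬝ᵥ (n ⨯₃ u))]
    · apply pow_eq_zero_iff two_ne_zero |>.mp
      nlinarith [sq_nonneg (e ⬝ᵥ u), sq_nonneg (e ⬝ᵥ (n ⨯₃ u))]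

/-! ### The scalar equations solved by `Ξ₁`, `Ξ₂₁` and `Ξ₂₂`. -/

/-- The number is the nonnegative root of `a r² + r = b`, in the rationalized form that also covers
`a = 0`. The three constants are the cases `(a, b) = (k, k)`, `(k(1 - ξ), k)` and `(kξ, kξ)`. -/
theorem quadratic_root {a b : ℝ} (ha : 0 ≤ a) (hb : 0 < b) :
    0 < 2 * b / (1 + √(1 + 4 * (a * b))) ∧ 2 * b / (1 + √(1 + 4 * (a * b))) ≤ b ∧
      a * (2 * b / (1 + √(1 + 4 * (a * b)))) ^ 2 + 2 * b / (1 + √(1 + 4 * (a * b))) = b := by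
  have h0 : 0 ≤ a * b := by positivity
  have h1 : √(1 + 4 * (a * b)) ^ 2 = 1 + 4 * (a * b) := Real.sq_sqrt (by linarith)
  have h2 : 0 ≤ √(1 + 4 * (a * b)) := Real.sqrt_nonneg _
  set r := √(1 + 4 * (a * b))
  have h3 : a * (2 * b / (1 + r)) ^ 2 + 2 * b / (1 + r) = b := by
    field_simp
    nlinarith
  have h4 : 0 < 2 * b / (1 + r) := by positivity
  refine ⟨h4, ?_, h3⟩
  have := mul_nonneg ha (sq_nonneg (2 * b / (1 + r)))
  linarith

theorem le_of_quadratic_le {a r s : ℝ} (ha : 0 ≤ a) (hs : 0 ≤ s) (hr : 0 ≤ r)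
    (h : a * r ^ 2 + r ≤ a * s ^ 2 + s) : r ≤ s := by
  by_contra! hc
  have : a * s ^ 2 ≤ a * r ^ 2 := mul_le_mul_of_nonneg_left (by nlinarith) ha
  linarith

theorem eq_of_quadratic_eq {a r s : ℝ} (ha : 0 ≤ a) (hs : 0 ≤ s) (hr : 0 ≤ r)
    (h : a * r ^ 2 + r = a * s ^ 2 + s) : r = s :=
  le_antisymm (le_of_quadratic_le ha hs hr h.le) (le_of_quadratic_le ha hr hs h.ge)

theorem Xi1_spec {k : ℝ} (hk : 0 < k) :
    0 < Xi1 k ∧ Xi1 k ≤ k ∧ k * Xi1 k ^ 2 + Xi1 k = k := by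
  have h := quadratic_root hk.le hk
  rwa [show k * k = k ^ 2 by ring] at h

theorem Xi21_spec {k ξ : ℝ} (hk : 0 < k) (hξ : ξ ≤ 1) :
    0 < Xi21 k ξ ∧ Xi21 k ξ ≤ k ∧ k * (1 - ξ) * Xi21 k ξ ^ 2 + Xi21 k ξ = k := by
  have h := quadratic_root (mul_nonneg hk.le (sub_nonneg.mpr hξ)) hk
  rwa [show 4 * (k * (1 - ξ) * k) = 4 * k ^ 2 * (1 - ξ) by ring] at h

theorem Xi22_spec {k ξ : ℝ} (hk : 0 < k) (hξ : 0 < ξ) :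
    0 < Xi22 k ξ ∧ Xi22 k ξ ≤ k * ξ ∧ k * ξ * Xi22 k ξ ^ 2 + Xi22 k ξ = k * ξ := by
  have h := quadratic_root (mul_pos hk hξ).le (mul_pos hk hξ)
  rwa [show 4 * (k * ξ * (k * ξ)) = 4 * k ^ 2 * ξ ^ 2 by ring,
    show 2 * (k * ξ) = 2 * k * ξ by ring] at h

theorem IsCritConfig.s_le {g h k : ℝ} {n u e : Vec} {s c : ℝ} (hg : 0 < g) (hh : 0 ≤ h) (hk : 0 < k)
    (hn : n ⬝ᵥ n = 1) (hu : u ⬝ᵥ u = 1) (hcfg : IsCritConfig g h k n u e s c) : s ≤ k := by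
  have h1 := (unwarp_eq hu hcfg.unit hcfg.sq_add_sq).1
  have h2 := axisForm_le (g := g) hh hn (unwarpVec u e s c)
  have h3 := hcfg.fixed
  have h4 : 0 < g + h := by linarith
  have h5 : unwarpVec u e s c ⬝ᵥ unwarpVec u e s c ≤ 1 := by nlinarith [sq_nonneg (s * (e ⬝ᵥ u))]
  have h6 : (g + h) * s ≤ (g + h) * k := by
    rw [h3, mul_comm (g + h) k]
    exact mul_le_mul_of_nonneg_left (by nlinarith) hk.le
  exact le_of_mul_le_mul_left h6 h4

theorem sq_mul_one_sub_sq_mono {r s : ℝ} (hr : 0 ≤ r) (hrs : r ≤ s) (hs : s ^ 2 ≤ 1 / 2) :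
    r ^ 2 * (1 - r ^ 2) ≤ s ^ 2 * (1 - s ^ 2) := by
  have : r ^ 2 ≤ s ^ 2 := pow_le_pow_left₀ hr hrs 2
  nlinarith

/-! ### A double largest eigenvalue of `M`: polar and equatorial half-turns. -/

section

variable {L ξ k : ℝ} {n u e : Vec} {s c : ℝ}

/-- On the axis the fixed-point equation reads `s = k(ξ + (1 - ξ)c²)`, which is the quadratic of
`Ξ₂₁`. -/
theorem polar_s_eq (hL : 0 < L) (hξ1 : ξ ≤ 1) (hk : 0 < k) (hu : IsPlanar n u)
    (hcfg : IsCritConfig (L * ξ) (L * (1 - ξ)) k n u e s c) (hz : (e ⬝ᵥ n) ^ 2 = 1)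
    (hx : e ⬝ᵥ u = 0) (hy : e ⬝ᵥ (n ⨯₃ u) = 0) : s = Xi21 k ξ := by
  obtain ⟨h1, -, h2⟩ := Xi21_spec hk hξ1
  have h3 := hcfg.fixed
  have h4 := hcfg.sq_add_sq
  rw [axisForm_unwarpVec_planar _ _ hu hcfg.unit h4, hx, hy] at h3
  have h5 : L * s = L * (k * (1 - (1 - ξ) * s ^ 2)) := by
    linear_combination h3 + k * (L * (1 - ξ)) * c ^ 2 * hz + k * L * (1 - ξ) * h4
  have h6 := mul_left_cancel₀ hL.ne' h5
  exact eq_of_quadratic_eq (mul_nonneg hk.le (sub_nonneg.mpr hξ1)) h1.le hcfg.s_nonneg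
    (by linarith)

/-- With `y` the component of `e` along `n × u`, the fixed-point equation is `s = k(ξ(1 - s²) +
s²y²)`. Dropping `y` leaves the quadratic of `Ξ₂₂`, so the bound is sharp at `e = ±u`. -/
theorem equatorial_le_s (hL : 0 < L) (hξ : 0 < ξ) (hk : 0 < k) (hu : IsPlanar n u)
    (hcfg : IsCritConfig (L * ξ) (L * (1 - ξ)) k n u e s c) (hz : e ⬝ᵥ n = 0) :
    Xi22 k ξ ≤ s := by
  obtain ⟨h1, -, h2⟩ := Xi22_spec hk hξ
  have h3 := hcfg.fixed
  have h4 := hcfg.sq_add_sq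
  have h5 := coord_sq_sum hu e
  rw [hcfg.unit, hz] at h5
  rw [axisForm_unwarpVec_planar _ _ hu hcfg.unit h4, hz] at h3
  set x := e ⬝ᵥ u
  set y := e ⬝ᵥ (n ⨯₃ u)
  have h6 : L * s = L * (k * (ξ * (1 - s ^ 2) + s ^ 2 * y ^ 2)) := by
    linear_combination h3 - k * L * ξ * s ^ 2 * h5
  have h7 := mul_left_cancel₀ hL.ne' h6
  have h8 : 0 ≤ k * (s ^ 2 * y ^ 2) := by positivity
  exact le_of_quadratic_le (mul_pos hk hξ).le hcfg.s_nonneg h1.le (by linarith)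

theorem polar_gain (hu : IsPlanar n u) (he : e ⬝ᵥ e = 1) (hsc : s ^ 2 + c ^ 2 = 1)
    (hz : (e ⬝ᵥ n) ^ 2 = 1) (hx : e ⬝ᵥ u = 0) (hy : e ⬝ᵥ (n ⨯₃ u) = 0) {κ τ : ℝ}
    (hκ : κ ^ 2 + τ ^ 2 = 1) :
    gain (L * ξ) (L * (1 - ξ)) n u e s c (κ • u + τ • (n ⨯₃ u)) =
      2 * L * (1 - κ) * s ^ 2 * (2 - s ^ 2 * (1 - κ) - 2 * (1 - s ^ 2) * ξ) := by
  rw [gain_planar _ _ hu he hsc hκ, hx, hy]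
  have hc : c ^ 2 = 1 - s ^ 2 := by linarith
  rw [hc]
  linear_combination 2 * (L * ξ * s ^ 4 * τ ^ 2 + L * (1 - ξ) * (1 - (1 - s ^ 2 + s ^ 2 * κ) ^ 2)) *
    hz + 2 * L * ξ * s ^ 4 * hκ

theorem equatorial_gain (hu : IsPlanar n u) (he : e ⬝ᵥ e = 1) (hsc : s ^ 2 + c ^ 2 = 1)
    (hz : e ⬝ᵥ n = 0) {κ τ : ℝ} (hκ : κ ^ 2 + τ ^ 2 = 1) :
    gain (L * ξ) (L * (1 - ξ)) n u e s c (κ • u + τ • (n ⨯₃ u)) =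
      2 * L * (s ^ 2 * (1 - s ^ 2)) *
        (2 * ξ * (1 - κ) - (τ * (e ⬝ᵥ u) + (1 - κ) * (e ⬝ᵥ (n ⨯₃ u))) ^ 2) := by
  rw [gain_planar _ _ hu he hsc hκ, hz]
  have h5 := coord_sq_sum hu e
  rw [he, hz] at h5
  set x := e ⬝ᵥ u
  set y := e ⬝ᵥ (n ⨯₃ u)
  have hc : c ^ 2 = 1 - s ^ 2 := by linarith
  -- The two linear forms in `(x, y)` are orthogonal of equal length, so their squares sum to `(1 -
  -- κ)² + τ² = 2(1 - κ)`.
  have h6 : ((1 - κ) * x - τ * y) ^ 2 = 2 * (1 - κ) - (τ * x + (1 - κ) * y) ^ 2 := by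
    linear_combination ((1 - κ) ^ 2 + τ ^ 2) * h5 + hκ
  have h7 : 2 * (L * ξ * (s * c * ((1 - κ) * x - τ * y) + s ^ 2 * τ * 0) ^ 2 +
      L * (1 - ξ) * (0 ^ 2 - ((c ^ 2 + s ^ 2 * κ) * 0 + c * s * (τ * x + (1 - κ) * y)) ^ 2)) =
      2 * L * (s ^ 2 * c ^ 2) * (ξ * ((1 - κ) * x - τ * y) ^ 2 -
        (1 - ξ) * (τ * x + (1 - κ) * y) ^ 2) := by ring
  rw [h7, h6, hc]
  ring

theorem polar_config (hξ1 : ξ ≤ 1) (hk : 0 < k) (hk1 : k < 1) (hu : IsPlanar n u) :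
    IsCritConfig (L * ξ) (L * (1 - ξ)) k n u n (Xi21 k ξ) (√(1 - Xi21 k ξ ^ 2)) := by
  obtain ⟨h1, h2, h3⟩ := Xi21_spec hk hξ1
  have h4 : √(1 - Xi21 k ξ ^ 2) ^ 2 = 1 - Xi21 k ξ ^ 2 := Real.sq_sqrt (by nlinarith)
  have h5 : Xi21 k ξ ^ 2 + √(1 - Xi21 k ξ ^ 2) ^ 2 = 1 := by linarith
  refine ⟨hu.axis_unit, by simp, h1.le, Real.sqrt_nonneg _, h5, ?_⟩
  rw [axisForm_unwarpVec_planar _ _ hu hu.axis_unit h5, dotProduct_comm n u, hu.orth, hu.axis_unit,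
    dot_self_cross]
  simp only [mul_zero, mul_one, add_zero, h4]
  linear_combination L * h3

theorem equatorial_config (hξ : 0 < ξ) (hξ1 : ξ ≤ 1) (hk : 0 < k) (hk1 : k < 1)
    (hu : IsPlanar n u) :
    IsCritConfig (L * ξ) (L * (1 - ξ)) k n u u (Xi22 k ξ) (√(1 - Xi22 k ξ ^ 2)) := by
  obtain ⟨h1, h2, h3⟩ := Xi22_spec hk hξ
  have h4 : √(1 - Xi22 k ξ ^ 2) ^ 2 = 1 - Xi22 k ξ ^ 2 :=
    Real.sq_sqrt (by nlinarith [mul_le_of_le_one_right hk.le hξ1])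
  have h5 : Xi22 k ξ ^ 2 + √(1 - Xi22 k ξ ^ 2) ^ 2 = 1 := by linarith
  refine ⟨hu.unit, by simp [hu.orth], h1.le, Real.sqrt_nonneg _, h5, ?_⟩
  rw [axisForm_unwarpVec_planar _ _ hu hu.unit h5, hu.unit, hu.orth, dot_cross_self]
  linear_combination L * h3

/-- The set of values of the largest gain over the directions in `N`. -/
def maxGains (g h k : ℝ) (n u : Vec) (N : Set Vec) : Set ℝ :=
  {r | ∃ e s c, IsCritConfig g h k n u e s c ∧ IsGreatest (gain g h n u e s c '' N) r}

theorem gapFour_pos (hL : 0 < L) (hξ : 1 / 2 < ξ) (hξ1 : ξ < 1) (hk : 0 < k)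
    (hk1 : k < 1) : 0 < gapFour k ξ L := by
  obtain ⟨h1, h2, -⟩ := Xi21_spec hk hξ1.le
  obtain ⟨h3, h4, -⟩ := Xi22_spec hk (by linarith : 0 < ξ)
  have h5 : Xi21 k ξ ^ 2 < 1 := by nlinarith
  have h6 : Xi22 k ξ ^ 2 < 1 := by nlinarith [mul_lt_one_of_nonneg_of_lt_one_left hk.le hk1 hξ1.le]
  refine mul_pos (by linarith) (lt_min (mul_pos (by positivity) ?_)
    (mul_pos (mul_pos (by positivity) ?_) ?_))
  · nlinarith [sq_nonneg (Xi21 k ξ)]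
  · linarith
  · linarith

theorem isLeast_maxGains_four (hL : 0 < L) (hξ : 1 / 2 < ξ) (hξ1 : ξ < 1) (hk : 0 < k)
    (hk2 : k ^ 2 < 1 / 2) (hu : IsPlanar n u) :
    IsLeast (maxGains (L * ξ) (L * (1 - ξ)) k n u {n ⨯₃ u, -(n ⨯₃ u)}) (gapFour k ξ L) := by
  have hξ0 : 0 < ξ := by linarith
  have hk1 : k < 1 := by nlinarith
  have hN : ({n ⨯₃ u, -(n ⨯₃ u)} : Set Vec) =
      {(0 : ℝ) • u + (1 : ℝ) • (n ⨯₃ u), (0 : ℝ) • u + (-1 : ℝ) • (n ⨯₃ u)} := by simp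
  rw [hN]
  have e1 : (0 : ℝ) ^ 2 + 1 ^ 2 = 1 := by norm_num
  have e2 : (0 : ℝ) ^ 2 + (-1) ^ 2 = 1 := by norm_num
  have hpolar : ∀ {e s c}, IsCritConfig (L * ξ) (L * (1 - ξ)) k n u e s c → (e ⬝ᵥ n) ^ 2 = 1 →
      e ⬝ᵥ u = 0 → e ⬝ᵥ (n ⨯₃ u) = 0 → ∀ τ : ℝ, (0 : ℝ) ^ 2 + τ ^ 2 = 1 →
      gain (L * ξ) (L * (1 - ξ)) n u e s c ((0 : ℝ) • u + τ • (n ⨯₃ u)) =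
      2 * L * (Xi21 k ξ ^ 2 * (1 + (1 - 2 * ξ) * (1 - Xi21 k ξ ^ 2))) := by
    intro e s c hcfg hz hx hy τ hτ
    rw [polar_gain hu hcfg.unit hcfg.sq_add_sq hz hx hy hτ,
      polar_s_eq hL hξ1.le hk hu hcfg hz hx hy]
    ring
  have hmax : ∀ {e s c} {t : ℝ},
      (∀ τ : ℝ, (0 : ℝ) ^ 2 + τ ^ 2 = 1 →
        gain (L * ξ) (L * (1 - ξ)) n u e s c ((0 : ℝ) • u + τ • (n ⨯₃ u)) = t) →
      IsGreatest (gain (L * ξ) (L * (1 - ξ)) n u e s c '' {(0 : ℝ) • u + (1 : ℝ) • (n ⨯₃ u),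
        (0 : ℝ) • u + (-1 : ℝ) • (n ⨯₃ u)}) t := by
    intro e s c t ht
    rw [Set.image_pair, ht 1 e1, ht (-1) e2, Set.pair_eq_singleton]
    exact isGreatest_singleton
  constructor
  · rw [gapFour]
    rcases min_choice (Xi21 k ξ ^ 2 * (1 + (1 - 2 * ξ) * (1 - Xi21 k ξ ^ 2)))
      (Xi22 k ξ ^ 2 * (1 - Xi22 k ξ ^ 2) * (2 * ξ - 1)) with h | h
    · rw [h]
      have hcfg := polar_config (L := L) hξ1.le hk hk1 hu
      refine ⟨_, _, _, hcfg, hmax (hpolar hcfg ?_ ?_ ?_)⟩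
      · rw [hu.axis_unit]; norm_num
      · rw [dotProduct_comm, hu.orth]
      · exact dot_self_cross _ _
    · rw [h]
      have hcfg := equatorial_config (L := L) hξ0 hξ1.le hk hk1 hu
      refine ⟨_, _, _, hcfg, hmax fun τ hτ => ?_⟩
      rw [equatorial_gain hu hcfg.unit hcfg.sq_add_sq hu.orth hτ, hu.unit, dot_cross_self]
      linear_combination (-2 * L * (Xi22 k ξ ^ 2 * (1 - Xi22 k ξ ^ 2))) * hτ
  · rintro r ⟨e, s, c, hcfg, hr⟩
    have hr1 := hr.2 ⟨_, .inl rfl, rfl⟩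
    have hr2 := hr.2 ⟨_, .inr rfl, rfl⟩
    rw [gapFour]
    rcases eigen_cases (mul_pos hL (by linarith)) hu hcfg.unit hcfg.eigen with hz | ⟨hz, hx, hy⟩
    · refine (mul_le_mul_of_nonneg_left (min_le_right _ _) (by linarith)).trans ?_
      rw [equatorial_gain hu hcfg.unit hcfg.sq_add_sq hz e1] at hr1
      rw [equatorial_gain hu hcfg.unit hcfg.sq_add_sq hz e2] at hr2
      have h1 := equatorial_le_s hL hξ0 hk hu hcfg hz
      have h2 := hcfg.s_le (by positivity) (mul_nonneg hL.le (by linarith)) hk hu.axis_unit hu.unit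
      have h3 : s ^ 2 ≤ 1 / 2 := by nlinarith [hcfg.s_nonneg]
      have h4 := sq_mul_one_sub_sq_mono (Xi22_spec hk hξ0).1.le h1 h3
      have h5 := coord_sq_sum hu e
      rw [hcfg.unit, hz] at h5
      have h6 : 0 ≤ s ^ 2 * (1 - s ^ 2) := mul_nonneg (sq_nonneg _) (by linarith)
      set A := s ^ 2 * (1 - s ^ 2)
      set x := e ⬝ᵥ u
      set y := e ⬝ᵥ (n ⨯₃ u)
      have h7 : 2 * L * (A * (2 * ξ - 1)) ≤ r := by
        have h8 : 0 ≤ 2 * L * A := by positivity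
        -- The better of the two directions has sign `τ` with `τxy ≤ 0`, so that `(τx + y)² ≤ x² +
        -- y² = 1`.
        rcases le_total 0 (x * y) with h9 | h9
        · have h10 := mul_nonneg h8 h9
          nlinarith [mul_nonneg h8 h9]
        · nlinarith [mul_nonneg h8 (neg_nonneg.mpr h9)]
      refine le_trans ?_ h7
      exact mul_le_mul_of_nonneg_left (mul_le_mul_of_nonneg_right h4 (by linarith)) (by linarith)
    · refine (mul_le_mul_of_nonneg_left (min_le_left _ _) (by linarith)).trans ?_
      rw [hpolar hcfg hz hx hy 1 e1] at hr1
      exact hr1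

theorem gapHex_pos (hL : 0 < L) (hξ : 1 / 2 ≤ ξ) (hξ1 : ξ < 1) (hk : 0 < k)
    (hk1 : k < 1) : 0 < gapHex k ξ L := by
  obtain ⟨h1, h2, -⟩ := Xi21_spec hk hξ1.le
  obtain ⟨h3, h4, -⟩ := Xi22_spec hk (by linarith : 0 < ξ)
  have h5 : Xi21 k ξ ^ 2 < 1 := by nlinarith
  have h6 : Xi22 k ξ ^ 2 < 1 := by nlinarith [mul_lt_one_of_nonneg_of_lt_one_left hk.le hk1 hξ1.le]
  refine mul_pos hL (lt_min (lt_max_of_lt_right (mul_pos (mul_pos (by positivity) ?_) ?_))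
    (mul_pos (mul_pos (by positivity) ?_) ?_)) <;> linarith

theorem gapHex_le (hL : 0 < L) (hξ : 1 / 2 ≤ ξ) (hξ1 : ξ < 1) (hk : 0 < k)
    (hk2 : k ^ 2 < 1 / 2) (hu : IsPlanar n u) {r : ℝ}
    (hr : r ∈ maxGains (L * ξ) (L * (1 - ξ)) k n u {-u, (1 / 2 : ℝ) • u + (√3 / 2) • (n ⨯₃ u),
      (1 / 2 : ℝ) • u + (-(√3 / 2)) • (n ⨯₃ u)}) : gapHex k ξ L ≤ r := by
  have hξ0 : 0 < ξ := by linarith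
  rw [show -u = (-1 : ℝ) • u + (0 : ℝ) • (n ⨯₃ u) by simp] at hr
  obtain ⟨e, s, c, hcfg, hr⟩ := hr
  have hr0 := hr.2 ⟨_, .inl rfl, rfl⟩
  have hr1 := hr.2 ⟨_, .inr (.inl rfl), rfl⟩
  have hr2 := hr.2 ⟨_, .inr (.inr rfl), rfl⟩
  have h3 : √3 ^ 2 = 3 := Real.sq_sqrt (by norm_num)
  have e0 : (-1 : ℝ) ^ 2 + 0 ^ 2 = 1 := by norm_num
  have e1 : (1 / 2 : ℝ) ^ 2 + (√3 / 2) ^ 2 = 1 := by linarith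
  have e2 : (1 / 2 : ℝ) ^ 2 + (-(√3 / 2)) ^ 2 = 1 := by linarith
  rw [gapHex]
  rcases eigen_cases (mul_pos hL (by linarith)) hu hcfg.unit hcfg.eigen with hz | ⟨hz, hx, hy⟩
  · refine (mul_le_mul_of_nonneg_left (min_le_right _ _) hL.le).trans ?_
    rw [equatorial_gain hu hcfg.unit hcfg.sq_add_sq hz e0] at hr0
    rw [equatorial_gain hu hcfg.unit hcfg.sq_add_sq hz e1] at hr1
    rw [equatorial_gain hu hcfg.unit hcfg.sq_add_sq hz e2] at hr2
    have h1 := equatorial_le_s hL hξ0 hk hu hcfg hz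
    have h2 := hcfg.s_le (by positivity) (mul_nonneg hL.le (by linarith)) hk hu.axis_unit hu.unit
    have h3' : s ^ 2 ≤ 1 / 2 := by nlinarith [hcfg.s_nonneg]
    have h4 := sq_mul_one_sub_sq_mono (Xi22_spec hk hξ0).1.le h1 h3'
    have h5 := coord_sq_sum hu e
    rw [hcfg.unit, hz] at h5
    have h6 : 0 ≤ s ^ 2 * (1 - s ^ 2) := mul_nonneg (sq_nonneg _) (by linarith)
    set A := s ^ 2 * (1 - s ^ 2)
    set x := e ⬝ᵥ u
    set y := e ⬝ᵥ (n ⨯₃ u)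
    have h7 : 2 * L * A * (ξ - 1 / 4) ≤ r := by
      have h8 : 0 ≤ 2 * L * A := by positivity
      -- For `|y| ≤ 1/2` the opposite direction `-u` is good enough; otherwise one of the two
      -- directions at angle `π/3` is.
      rcases le_total (y ^ 2) (1 / 4) with h9 | h9
      · exact (mul_le_mul_of_nonneg_left (by nlinarith) h8).trans hr0
      -- Since `x² + y² = 1`, this amounts to `|x| ≤ √3 |y|`, which is `y² ≥ 1/4`. The sign in
      -- `±√3/2` is then chosen so that the terms in `x` and `y` partly cancel.
      · have h10 : (√3 * |x| - |y|) ^ 2 ≤ 1 := by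
          have hx2 := sq_abs x
          have hy2 := sq_abs y
          have hxn := abs_nonneg x
          have hyn := abs_nonneg y
          have hyx : |x| ≤ √3 * |y| := by
            apply abs_le_of_sq_le_sq' _ (by positivity) |>.2
            rw [mul_pow, h3, hx2, hy2]
            linarith
          have h11 : |x| * |x| ≤ |x| * (√3 * |y|) := mul_le_mul_of_nonneg_left hyx hxn
          nlinarith
        have h12 : (√3 / 2 * x + (1 - 1 / 2) * y) ^ 2 ≤ 1 / 4 ∨
            (-(√3 / 2) * x + (1 - 1 / 2) * y) ^ 2 ≤ 1 / 4 := by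
          rcases abs_choice x with hx | hx <;> rcases abs_choice y with hy | hy <;>
            rw [hx, hy] at h10
          · right; linarith
          · left; linarith
          · left; linarith
          · right; linarith
        rcases h12 with h12 | h12
        · exact (mul_le_mul_of_nonneg_left (by linarith) h8).trans hr1
        · exact (mul_le_mul_of_nonneg_left (by linarith) h8).trans hr2
    refine le_trans ?_ h7
    have h8 : 0 ≤ 2 * L * (ξ - 1 / 4) := mul_nonneg (by linarith) (by linarith)
    have h9 := mul_le_mul_of_nonneg_left h4 h8
    linarith
  · refine (mul_le_mul_of_nonneg_left (min_le_left _ _) hL.le).trans ?_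
    rw [polar_gain hu hcfg.unit hcfg.sq_add_sq hz hx hy e0,
      polar_s_eq hL hξ1.le hk hu hcfg hz hx hy] at hr0
    rw [polar_gain hu hcfg.unit hcfg.sq_add_sq hz hx hy e1,
      polar_s_eq hL hξ1.le hk hu hcfg hz hx hy] at hr1
    rw [mul_max_of_nonneg _ _ hL.le]
    apply max_le
    · refine le_trans (le_of_eq ?_) hr1
      ring
    · refine le_trans (le_of_eq ?_) hr0
      ring

end

/-! ### A triple eigenvalue of `M`. -/

theorem gapTriple_pos {k μ : ℝ} (hμ : 0 < μ) (hk : 0 < k) (hk1 : k < 1) : 0 < gapTriple k μ := by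
  obtain ⟨h1, h2, -⟩ := Xi1_spec hk
  have h3 : Xi1 k ^ 2 < 1 := by nlinarith
  exact mul_pos (by linarith) (lt_min (by positivity) (mul_pos (by positivity) (by linarith)))

/-- The concavity estimate behind the triple eigenvalue. -/
theorem triple_lower_bound {k s c x T : ℝ} (hk : 0 < k) (hk1 : k < 1) (hs : 0 ≤ s) (hc : 0 ≤ c)
    (hsc : s ^ 2 + c ^ 2 = 1) (hfix : s = k * (1 - (s * x) ^ 2)) (hx : 0 ≤ x) (hT : 0 ≤ T)
    (hxT : 2 * T ^ 2 = 1 - x ^ 2) :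
    min (k ^ 2) (2 * Xi1 k ^ 2 * (1 - Xi1 k ^ 2)) ≤ 2 * (s * (c * x + T)) ^ 2 := by
  obtain ⟨hΞ, hΞk, hΞeq⟩ := Xi1_spec hk
  set Ξ := Xi1 k
  have hΞ1 : Ξ ^ 2 < 1 := by nlinarith
  have hw : (s * x) ^ 2 ≤ Ξ ^ 2 := by
    have h1 : s ≤ Ξ ∨ Ξ < s := le_or_gt _ _
    have hx1 : x ^ 2 ≤ 1 := by nlinarith [sq_nonneg T]
    rcases h1 with h1 | h1
    · rw [mul_pow]
      nlinarith [pow_le_pow_left₀ hs h1 2, sq_nonneg s]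
    · have : k * (s * x) ^ 2 ≤ k * Ξ ^ 2 := by linarith
      exact le_of_mul_le_mul_left this hk
  -- The parameter `τ` interpolates between `x = 0` and `x = 1`: the fixed-point equation is affine
  -- in `(s x)²`, so `s` is the corresponding convex combination of `k` and `Ξ`.
  obtain ⟨τ, hτ⟩ : ∃ τ, (s * x) ^ 2 = τ * Ξ ^ 2 := ⟨(s * x) ^ 2 / Ξ ^ 2, by field_simp⟩
  have hτ0 : 0 ≤ τ := by
    by_contra! h
    nlinarith [sq_nonneg (s * x), pow_pos hΞ 2]
  have hτ1 : τ ≤ 1 := by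
    by_contra! h
    nlinarith [pow_pos hΞ 2]
  have hs_eq : s = (1 - τ) * k + τ * Ξ := by
    rw [hfix, hτ]
    linear_combination -τ * hΞeq
  set P := Ξ * √(1 - Ξ ^ 2)
  have hP2 : P ^ 2 = Ξ ^ 2 * (1 - Ξ ^ 2) := by
    rw [mul_pow, Real.sq_sqrt (by linarith)]
  have hP : 0 ≤ P := mul_nonneg hΞ.le (Real.sqrt_nonneg _)
  set K := k * √(1 / 2)
  have hK2 : K ^ 2 = k ^ 2 / 2 := by
    rw [mul_pow, Real.sq_sqrt (by norm_num)]; ring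
  have hK : 0 ≤ K := mul_nonneg hk.le (Real.sqrt_nonneg _)
  have h1 : τ * P ≤ s * c * x := by
    apply abs_le_of_sq_le_sq' _ (by positivity) |>.2
    -- Convexity of the square bounds `s²` above by its interpolation, hence `c²` below by that of
    -- `1 - k²` and `1 - Ξ²`; the first contribution is dropped.
    have h2 : τ * (1 - Ξ ^ 2) ≤ c ^ 2 := by
      have h3 : s ^ 2 ≤ (1 - τ) * k ^ 2 + τ * Ξ ^ 2 := by
        rw [hs_eq]
        nlinarith [mul_nonneg (mul_nonneg hτ0 (sub_nonneg.mpr hτ1)) (sq_nonneg (k - Ξ))]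
      nlinarith [mul_nonneg (sub_nonneg.mpr hτ1) (by nlinarith : 0 ≤ 1 - k ^ 2)]
    calc (τ * P) ^ 2 = (τ * Ξ ^ 2) * (τ * (1 - Ξ ^ 2)) := by rw [mul_pow, hP2]; ring
      _ ≤ (τ * Ξ ^ 2) * c ^ 2 := mul_le_mul_of_nonneg_left h2 (by positivity)
      _ = (s * c * x) ^ 2 := by rw [← hτ]; ring
  have h2 : (1 - τ) * K ≤ s * T := by
    apply abs_le_of_sq_le_sq' _ (by positivity) |>.2
    have h3 : (1 - τ) ^ 2 * k ^ 2 ≤ s ^ 2 - τ * Ξ ^ 2 := by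
      rw [hs_eq]
      have : 0 ≤ 2 * k * Ξ - Ξ ^ 2 := by nlinarith
      nlinarith [mul_nonneg (mul_nonneg hτ0 (sub_nonneg.mpr hτ1)) this]
    have h4 : (s * T) ^ 2 = (s ^ 2 - τ * Ξ ^ 2) / 2 := by
      rw [← hτ]
      linear_combination s ^ 2 / 2 * hxT
    rw [mul_pow, hK2, h4]
    linarith
  -- The two summands dominate `τ P` and `(1 - τ) K`, so their sum dominates a convex combination of
  -- `P` and `K`.
  have h3 : min P K ≤ s * (c * x + T) := by
    have := mul_le_mul_of_nonneg_left (min_le_left P K) hτ0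
    have := mul_le_mul_of_nonneg_left (min_le_right P K) (sub_nonneg.mpr hτ1)
    linarith
  have h4 := pow_le_pow_left₀ (le_min hP hK) h3 2
  rcases min_choice P K with h5 | h5 <;> rw [h5] at h4
  · exact (min_le_right _ _).trans (by linarith)
  · exact (min_le_left _ _).trans (by linarith)

theorem isLeast_maxGains_triple {k μ : ℝ} (hμ : 0 < μ) (hk : 0 < k) (hk1 : k < 1) {n u a : Vec}
    (hu : IsPlanar u a) :
    IsLeast (maxGains (2 * μ) 0 k n u {a, -a, u ⨯₃ a, -(u ⨯₃ a)}) (gapTriple k μ) := by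
  have hb := cross_unit hu
  have hgain : ∀ {e s c p}, p ⬝ᵥ p = 1 → e ⬝ᵥ e = 1 → s ^ 2 + c ^ 2 = 1 →
      gain (2 * μ) 0 n u e s c p =
        4 * μ * (s * (c * (e ⬝ᵥ u - e ⬝ᵥ p) + s * ((e ⨯₃ u) ⬝ᵥ p))) ^ 2 := by
    intro e s c p hp he hsc
    rw [gain_eq _ _ hu.axis_unit he hp hsc]
    ring
  have hcross1 : ∀ e : Vec, (e ⨯₃ u) ⬝ᵥ a = e ⬝ᵥ (u ⨯₃ a) := fun e => by
    simp only [dot_eq, cross_zero, cross_one, cross_two]; ring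
  have hcross2 : ∀ e : Vec, (e ⨯₃ u) ⬝ᵥ (u ⨯₃ a) = -(e ⬝ᵥ a) := fun e => by
    rw [cross_dot_cross, hu.axis_unit, dotProduct_comm u a, hu.orth]; ring
  have hform : ∀ {e s c}, e ⬝ᵥ e = 1 → s ^ 2 + c ^ 2 = 1 →
      axisForm (2 * μ) 0 n (unwarpVec u e s c) = 2 * μ * (1 - (s * (e ⬝ᵥ u)) ^ 2) := by
    intro e s c he hsc
    rw [axisForm_unwarpVec _ _ hu.axis_unit he hsc]
    ring
  have hg1 : ∀ {e s c}, e ⬝ᵥ e = 1 → s ^ 2 + c ^ 2 = 1 → gain (2 * μ) 0 n u e s c a =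
      4 * μ * (s * (c * (e ⬝ᵥ u) + (s * (e ⬝ᵥ (u ⨯₃ a)) - c * (e ⬝ᵥ a)))) ^ 2 := by
    intro e s c he hsc
    rw [hgain hu.unit he hsc, hcross1]; ring
  have hg2 : ∀ {e s c}, e ⬝ᵥ e = 1 → s ^ 2 + c ^ 2 = 1 → gain (2 * μ) 0 n u e s c (-a) =
      4 * μ * (s * (c * (e ⬝ᵥ u) - (s * (e ⬝ᵥ (u ⨯₃ a)) - c * (e ⬝ᵥ a)))) ^ 2 := by
    intro e s c he hsc
    rw [hgain (by simpa using hu.unit) he hsc, dotProduct_neg, dotProduct_neg, hcross1]; ring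
  have hg3 : ∀ {e s c}, e ⬝ᵥ e = 1 → s ^ 2 + c ^ 2 = 1 → gain (2 * μ) 0 n u e s c (u ⨯₃ a) =
      4 * μ * (s * (c * (e ⬝ᵥ u) - (s * (e ⬝ᵥ a) + c * (e ⬝ᵥ (u ⨯₃ a))))) ^ 2 := by
    intro e s c he hsc
    rw [hgain hb he hsc, hcross2]; ring
  have hg4 : ∀ {e s c}, e ⬝ᵥ e = 1 → s ^ 2 + c ^ 2 = 1 → gain (2 * μ) 0 n u e s c (-(u ⨯₃ a)) =
      4 * μ * (s * (c * (e ⬝ᵥ u) + (s * (e ⬝ᵥ a) + c * (e ⬝ᵥ (u ⨯₃ a))))) ^ 2 := by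
    intro e s c he hsc
    rw [hgain (by rwa [neg_dotProduct, dotProduct_neg, neg_neg]) he hsc, dotProduct_neg,
      dotProduct_neg, hcross2]
    ring
  have hall : ∀ {e s c} {t : ℝ}, e ⬝ᵥ e = 1 → s ^ 2 + c ^ 2 = 1 →
      4 * μ * (s * (c * (e ⬝ᵥ u) + (s * (e ⬝ᵥ (u ⨯₃ a)) - c * (e ⬝ᵥ a)))) ^ 2 = t →
      4 * μ * (s * (c * (e ⬝ᵥ u) - (s * (e ⬝ᵥ (u ⨯₃ a)) - c * (e ⬝ᵥ a)))) ^ 2 = t →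
      4 * μ * (s * (c * (e ⬝ᵥ u) - (s * (e ⬝ᵥ a) + c * (e ⬝ᵥ (u ⨯₃ a))))) ^ 2 = t →
      4 * μ * (s * (c * (e ⬝ᵥ u) + (s * (e ⬝ᵥ a) + c * (e ⬝ᵥ (u ⨯₃ a))))) ^ 2 = t →
      IsGreatest (gain (2 * μ) 0 n u e s c '' {a, -a, u ⨯₃ a, -(u ⨯₃ a)}) t := by
    intro e s c t he hsc h1 h2 h3 h4
    rw [Set.image_insert_eq, Set.image_insert_eq, Set.image_pair, hg1 he hsc, hg2 he hsc,
      hg3 he hsc, hg4 he hsc, h1, h2, h3, h4]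
    simp
  obtain ⟨hΞ, hΞk, hΞeq⟩ := Xi1_spec hk
  constructor
  · rw [gapTriple]
    rcases min_choice (k ^ 2) (2 * Xi1 k ^ 2 * (1 - Xi1 k ^ 2)) with h | h
    · rw [h]
      have hc2 : √(1 - k ^ 2) ^ 2 = 1 - k ^ 2 := Real.sq_sqrt (by nlinarith)
      set c := √(1 - k ^ 2) with hc
      have hsc : k ^ 2 + c ^ 2 = 1 := by linarith
      have h2 : √(1 / 2) ^ 2 = 1 / 2 := Real.sq_sqrt (by norm_num)
      set d := √(1 / 2)
      -- This axis is orthogonal to `u`, so `s = k`. It is rotated within that plane so that `s z -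
      -- c y` and `s y + c z` agree, which makes all four gains equal.
      set e : Vec := (d * (k - c)) • a + (d * (k + c)) • (u ⨯₃ a) with he_def
      have hab : a ⬝ᵥ (u ⨯₃ a) = 0 := dot_cross_self u a
      have hub : u ⬝ᵥ (u ⨯₃ a) = 0 := dot_self_cross u a
      have hex : e ⬝ᵥ u = 0 := by
        simp [he_def, hu.orth, dotProduct_comm (u ⨯₃ a) u]
      have hey : e ⬝ᵥ a = d * (k - c) := by
        simp [he_def, hu.unit, dotProduct_comm (u ⨯₃ a) a]
      have hez : e ⬝ᵥ (u ⨯₃ a) = d * (k + c) := by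
        simp [he_def, hb, hab]
      have he : e ⬝ᵥ e = 1 := by
        conv_lhs => rw [he_def, dotProduct_add, dotProduct_smul, dotProduct_smul, hey, hez]
        simp only [smul_eq_mul]
        linear_combination 2 * d ^ 2 * hsc + 2 * h2
      refine ⟨e, k, c, ⟨he, by simp, hk.le, Real.sqrt_nonneg _, hsc, ?_⟩, ?_⟩
      · rw [hform he hsc, hex]; ring
      · have hA : k * (d * (k + c)) - c * (d * (k - c)) = d := by linear_combination d * hsc
        have hB : k * (d * (k - c)) + c * (d * (k + c)) = d := by linear_combination d * hsc
        apply hall he hsc <;> rw [hex, hey, hez] <;> simp only [hA, hB] <;>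
          linear_combination 4 * μ * k ^ 2 * h2
    · rw [h]
      have hc2 : √(1 - Xi1 k ^ 2) ^ 2 = 1 - Xi1 k ^ 2 := Real.sq_sqrt (by nlinarith)
      set c := √(1 - Xi1 k ^ 2) with hc
      have hsc : Xi1 k ^ 2 + c ^ 2 = 1 := by linarith
      refine ⟨u, Xi1 k, c, ⟨hu.axis_unit, by simp, hΞ.le, Real.sqrt_nonneg _, hsc, ?_⟩, ?_⟩
      · rw [hform hu.axis_unit hsc, hu.axis_unit]
        linear_combination 2 * μ * hΞeq
      · apply hall hu.axis_unit hsc <;>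
          rw [hu.axis_unit, dotProduct_comm u a, hu.orth, dot_self_cross] <;>
          linear_combination 4 * μ * Xi1 k ^ 2 * hc2
  · rintro r ⟨e, s, c, hcfg, hr⟩
    have he := hcfg.unit
    have hsc := hcfg.sq_add_sq
    have hr1 := hr.2 ⟨a, by simp, hg1 he hsc⟩
    have hr2 := hr.2 ⟨-a, by simp, hg2 he hsc⟩
    have hr3 := hr.2 ⟨u ⨯₃ a, by simp, hg3 he hsc⟩
    have hr4 := hr.2 ⟨-(u ⨯₃ a), by simp, hg4 he hsc⟩
    have hsum := coord_sq_sum hu e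
    rw [he] at hsum
    have hfix := hcfg.fixed
    rw [hform he hsc] at hfix
    have hs := hcfg.s_nonneg
    have hc := hcfg.c_nonneg
    set x := e ⬝ᵥ u
    set y := e ⬝ᵥ a
    set z := e ⬝ᵥ (u ⨯₃ a)
    set A := s * z - c * y with hA
    set B := s * y + c * z with hB
    -- `(A, B)` is, up to reflection, a rotation of `(y, z)`, so the larger of `|A|`, `|B|` is at
    -- least `T`. Each comes with both signs among the four directions, so one gain has `c|x|` and
    -- that modulus adding up.
    have hAB : A ^ 2 + B ^ 2 = 1 - x ^ 2 := by
      rw [hA, hB]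
      linear_combination (y ^ 2 + z ^ 2) * hsc + hsum
    have hx1 : 0 ≤ (1 - x ^ 2) / 2 := by nlinarith [sq_nonneg A, sq_nonneg B]
    have hT2 : √((1 - x ^ 2) / 2) ^ 2 = (1 - x ^ 2) / 2 := Real.sq_sqrt hx1
    have hT := Real.sqrt_nonneg ((1 - x ^ 2) / 2)
    set T := √((1 - x ^ 2) / 2)
    have hfix' : s = k * (1 - (s * |x|) ^ 2) := by
      rw [mul_pow, sq_abs, ← mul_pow]
      apply mul_left_cancel₀ (by positivity : 2 * μ ≠ 0)
      linarith
    have hlow := triple_lower_bound hk hk1 hs hc hsc hfix' (abs_nonneg x) hT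
      (by rw [sq_abs]; linarith)
    have hpm : ∀ D : ℝ, T ≤ |D| → 4 * μ * (s * (c * x + D)) ^ 2 ≤ r →
        4 * μ * (s * (c * x - D)) ^ 2 ≤ r → 4 * μ * (s * (c * |x| + T)) ^ 2 ≤ r := by
      intro D hD hp hm
      have h1 : (s * (c * |x| + T)) ^ 2 ≤ (s * (c * |x| + |D|)) ^ 2 := by gcongr
      have h2 : 4 * μ * (s * (c * |x| + |D|)) ^ 2 ≤ r := by
        rcases abs_choice x with hx | hx <;> rcases abs_choice D with hD' | hD' <;> rw [hx, hD']
        · exact hp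
        · exact hm
        · refine le_trans (le_of_eq ?_) hm; ring
        · refine le_trans (le_of_eq ?_) hp; ring
      exact (mul_le_mul_of_nonneg_left h1 (by positivity)).trans h2
    have hfin : 4 * μ * (s * (c * |x| + T)) ^ 2 ≤ r := by
      rcases le_total (B ^ 2) (A ^ 2) with hle | hle
      · refine hpm A ?_ hr1 hr2
        exact abs_le_of_sq_le_sq' (by rw [sq_abs]; linarith) (abs_nonneg _) |>.2
      · refine hpm B ?_ hr4 hr3
        exact abs_le_of_sq_le_sq' (by rw [sq_abs]; linarith) (abs_nonneg _) |>.2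
    rw [gapTriple]
    have := mul_le_mul_of_nonneg_left hlow (by positivity : 0 ≤ 2 * μ)
    linarith

/-! ### Reduction to an axis and the neighbour sets of the directions. -/

theorem eq_axisMat {M : Mat} {lam : Fin 3 → ℝ} {v : Fin 3 → Vec}
    (hv : IsOrthonormalEigenbasis M lam v) (h01 : lam 0 = lam 1) :
    M = axisMat (lam 0 + lam 2) (lam 0 - lam 2) (v 2) := by
  obtain ⟨horth, heig⟩ := hv
  set P : Mat := Matrix.of v
  have hP : P * Pᵀ = 1 := by
    ext i j
    rw [Matrix.one_apply, ← horth i j]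
    rfl
  have hA : ∀ i, axisMat (lam 0 + lam 2) (lam 0 - lam 2) (v 2) *ᵥ v i = lam i • v i := by
    intro i
    rw [axisMat, Matrix.sub_mulVec, Matrix.smul_mulVec, Matrix.smul_mulVec, Matrix.one_mulVec,
      Matrix.vecMulVec_mulVec, horth 2 i]
    ext j
    fin_cases i
    · simp
    · simp [← h01]
    · simp
      ring
  have hMP : M * Pᵀ = axisMat (lam 0 + lam 2) (lam 0 - lam 2) (v 2) * Pᵀ := by
    ext i j
    exact congrFun ((heig j).trans (hA j).symm) i
  calc M = M * (Pᵀ * P) := by rw [mul_eq_one_comm.mp hP, mul_one]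
    _ = _ := by rw [← mul_assoc, hMP, mul_assoc, mul_eq_one_comm.mp hP, mul_one]

/-- Orthonormal triples are `(w, a, ± w × a)`. -/
theorem eq_cross_or_eq_neg_cross {w a b : Vec} (hw : IsPlanar w a) (hb : b ⬝ᵥ b = 1)
    (hbw : b ⬝ᵥ w = 0) (hba : b ⬝ᵥ a = 0) : b = w ⨯₃ a ∨ b = -(w ⨯₃ a) := by
  have h1 := coord_sq_sum hw b
  rw [hb, hbw, hba] at h1
  have h2 := cross_unit hw
  have h3 : (b ⬝ᵥ (w ⨯₃ a) - 1) * (b ⬝ᵥ (w ⨯₃ a) + 1) = 0 := by linarith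
  rcases mul_eq_zero.mp h3 with h4 | h4
  · left
    rw [← sub_eq_zero, ← dotProduct_self_eq_zero]
    simp only [sub_dotProduct, dotProduct_sub, hb, h2, dotProduct_comm (w ⨯₃ a) b]
    linarith
  · right
    rw [← sub_eq_zero, ← dotProduct_self_eq_zero]
    simp only [sub_neg_eq_add, add_dotProduct, dotProduct_add, hb, h2, dotProduct_comm (w ⨯₃ a) b]
    linarith

/-- The set is symmetric under sign, so the orientation of the basis does not matter and `b` may be
replaced by `w × a`. -/
theorem perpDirs_six {w a b : Vec} (hw : IsPlanar w a) (hb : b ⬝ᵥ b = 1)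
    (hbw : b ⬝ᵥ w = 0) (hba : b ⬝ᵥ a = 0) {U : Set Vec} (hU : U = {w, -w, a, -a, b, -b}) :
    perpDirs U w = {a, -a, w ⨯₃ a, -(w ⨯₃ a)} := by
  have h1 : perpDirs U w = {a, -a, b, -b} := by
    subst hU
    ext x
    simp only [perpDirs, Set.mem_ofPred_eq, Set.mem_insert_iff, Set.mem_singleton_iff]
    constructor
    · rintro ⟨rfl | rfl | h, hx⟩
      · rw [hw.axis_unit] at hx; norm_num at hx
      · rw [neg_dotProduct, hw.axis_unit] at hx; norm_num at hx
      · exact h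
    · intro h
      refine ⟨.inr (.inr h), ?_⟩
      rcases h with rfl | rfl | rfl | rfl <;> simp [hw.orth, hbw]
  rw [h1]
  rcases eq_cross_or_eq_neg_cross hw hb hbw hba with rfl | rfl
  · rfl
  · rw [neg_neg, Set.pair_comm (-(w ⨯₃ a))]

theorem perpDirs_four {n w b : Vec} (hw : IsPlanar n w) (hb : b ⬝ᵥ b = 1)
    (hbn : b ⬝ᵥ n = 0) (hbw : b ⬝ᵥ w = 0) {U : Set Vec} (hU : U = {w, -w, b, -b}) :
    perpDirs U w = {n ⨯₃ w, -(n ⨯₃ w)} := by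
  have h1 : perpDirs U w = {b, -b} := by
    subst hU
    ext x
    simp only [perpDirs, Set.mem_ofPred_eq, Set.mem_insert_iff, Set.mem_singleton_iff]
    constructor
    · rintro ⟨rfl | rfl | h, hx⟩
      · rw [hw.unit] at hx; norm_num at hx
      · rw [neg_dotProduct, hw.unit] at hx; norm_num at hx
      · exact h
    · intro h
      refine ⟨.inr (.inr h), ?_⟩
      rcases h with rfl | rfl <;> simp [hbw]
  rw [h1]
  rcases eq_cross_or_eq_neg_cross hw hb hbn hbw with rfl | rfl
  · rfl
  · rw [neg_neg, Set.pair_comm]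

theorem IsPlanar.neg_axis {n w : Vec} (h : IsPlanar n w) : IsPlanar (-n) w :=
  ⟨by simpa using h.axis_unit, h.unit, by simpa using h.orth⟩

theorem IsPlanar.neg {n w : Vec} (h : IsPlanar n w) : IsPlanar n (-w) :=
  ⟨h.axis_unit, by simpa using h.unit, by simpa using h.orth⟩

theorem isPlanar_of_ne {v : Fin 3 → Vec} (hv : ∀ i j, v i ⬝ᵥ v j = if i = j then 1 else 0)
    {i j : Fin 3} (hij : i ≠ j) : IsPlanar (v i) (v j) :=
  ⟨by simp [hv], by simp [hv], by simp [hv, hij.symm]⟩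

theorem perpDirs_dirs6 {v : Fin 3 → Vec} (hv : ∀ i j, v i ⬝ᵥ v j = if i = j then 1 else 0)
    {w : Vec} (hw : w ∈ dirs6 v) :
    ∃ a, IsPlanar w a ∧ perpDirs (dirs6 v) w = {a, -a, w ⨯₃ a, -(w ⨯₃ a)} := by
  have key : ∀ i j l : Fin 3, i ≠ j → i ≠ l → j ≠ l → ∀ w, (w = v i ∨ w = -v i) →
      dirs6 v = {w, -w, v j, -v j, v l, -v l} →
      ∃ a, IsPlanar w a ∧ perpDirs (dirs6 v) w = {a, -a, w ⨯₃ a, -(w ⨯₃ a)} := by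
    intro i j l hij hil hjl w hw hU
    have hlj : v l ⬝ᵥ v j = 0 := by simp [hv, hjl.symm]
    have hll : v l ⬝ᵥ v l = 1 := by simp [hv]
    have hli : v l ⬝ᵥ v i = 0 := by simp [hv, hil.symm]
    refine ⟨v j, ?_⟩
    have hp := isPlanar_of_ne hv hij
    rcases hw with rfl | rfl
    · exact ⟨hp, perpDirs_six hp hll hli hlj hU⟩
    · exact ⟨hp.neg_axis, perpDirs_six hp.neg_axis hll (by simpa using hli) hlj hU⟩
  have hw' := hw
  simp only [dirs6, Set.mem_insert_iff, Set.mem_singleton_iff] at hw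
  rcases hw with rfl | rfl | rfl | rfl | rfl | rfl
  · exact key 0 1 2 (by decide) (by decide) (by decide) _ (.inl rfl) rfl
  · refine key 0 1 2 (by decide) (by decide) (by decide) _ (.inr rfl) ?_
    rw [neg_neg, dirs6, Set.insert_comm]
  · refine key 1 0 2 (by decide) (by decide) (by decide) _ (.inl rfl) ?_
    ext x; simp only [dirs6, Set.mem_insert_iff, Set.mem_singleton_iff]; tauto
  · refine key 1 0 2 (by decide) (by decide) (by decide) _ (.inr rfl) ?_
    ext x; simp only [dirs6, Set.mem_insert_iff, Set.mem_singleton_iff, neg_neg]; tauto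
  · refine key 2 0 1 (by decide) (by decide) (by decide) _ (.inl rfl) ?_
    ext x; simp only [dirs6, Set.mem_insert_iff, Set.mem_singleton_iff]; tauto
  · refine key 2 0 1 (by decide) (by decide) (by decide) _ (.inr rfl) ?_
    ext x; simp only [dirs6, Set.mem_insert_iff, Set.mem_singleton_iff, neg_neg]; tauto

theorem perpDirs_dirs4 {v : Fin 3 → Vec} (hv : ∀ i j, v i ⬝ᵥ v j = if i = j then 1 else 0)
    {w : Vec} (hw : w ∈ dirs4 v) :
    IsPlanar (v 2) w ∧ perpDirs (dirs4 v) w = {v 2 ⨯₃ w, -(v 2 ⨯₃ w)} := by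
  have hp0 := isPlanar_of_ne hv (show (2 : Fin 3) ≠ 0 by decide)
  have hp1 := isPlanar_of_ne hv (show (2 : Fin 3) ≠ 1 by decide)
  have h01 : v 0 ⬝ᵥ v 1 = 0 := by simp [hv]
  have h10 : v 1 ⬝ᵥ v 0 = 0 := by simp [hv]
  simp only [dirs4, Set.mem_insert_iff, Set.mem_singleton_iff] at hw
  rcases hw with rfl | rfl | rfl | rfl
  · exact ⟨hp0, perpDirs_four hp0 hp1.unit hp1.orth h10 rfl⟩
  · refine ⟨hp0.neg, perpDirs_four hp0.neg hp1.unit hp1.orth (by simpa using h10) ?_⟩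
    rw [neg_neg, dirs4, Set.insert_comm]
  · refine ⟨hp1, perpDirs_four hp1 hp0.unit hp0.orth h01 ?_⟩
    ext x; simp only [dirs4, Set.mem_insert_iff, Set.mem_singleton_iff]; tauto
  · refine ⟨hp1.neg, perpDirs_four hp1.neg hp0.unit hp0.orth (by simpa using h01) ?_⟩
    ext x; simp only [dirs4, Set.mem_insert_iff, Set.mem_singleton_iff, neg_neg]; tauto

theorem hexNeighbours_dirsHex {v : Fin 3 → Vec} (hv : ∀ i j, v i ⬝ᵥ v j = if i = j then 1 else 0)
    {w : Vec} (hw : w ∈ dirsHex v) :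
    IsPlanar (v 2) w ∧ hexNeighbours (dirsHex v) w = {-w,
      (1 / 2 : ℝ) • w + (√3 / 2) • (v 2 ⨯₃ w), (1 / 2 : ℝ) • w + (-(√3 / 2)) • (v 2 ⨯₃ w)} := by
  obtain ⟨n, hn⟩ := hw
  set φ := n * Real.pi / 3
  -- `b` is `w` turned by a right angle in the plane, so `hdir` below expresses each hexagon
  -- direction through its angle relative to `w`.
  set b := (-Real.sin φ) • v 0 + Real.cos φ • v 1 with hb_def
  have hcs := Real.cos_sq_add_sin_sq φ
  have hww : w ⬝ᵥ w = 1 := by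
    simp [hn, hv]; linarith
  have hwn : w ⬝ᵥ v 2 = 0 := by simp [hn, hv]
  have hp : IsPlanar (v 2) w := ⟨by simp [hv], hww, hwn⟩
  have hbb : b ⬝ᵥ b = 1 := by
    simp [hb_def, hv]; linarith
  have hbn : b ⬝ᵥ v 2 = 0 := by simp [hb_def, hv]
  have hbw : b ⬝ᵥ w = 0 := by
    simp [hb_def, hn, hv]; ring
  have hdir : ∀ t : ℝ, Real.cos (φ + t) • v 0 + Real.sin (φ + t) • v 1 =
      Real.cos t • w + Real.sin t • b := by
    intro t
    rw [hn, hb_def, Real.cos_add, Real.sin_add]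
    module
  have h3 : √3 ^ 2 = 3 := Real.sq_sqrt (by norm_num)
  have hset : hexNeighbours (dirsHex v) w = {-w, (1 / 2 : ℝ) • w + (√3 / 2) • b,
      (1 / 2 : ℝ) • w + (-(√3 / 2)) • b} := by
    ext x
    simp only [hexNeighbours, Set.mem_union, Set.mem_singleton_iff, Set.mem_ofPred_eq,
      Set.mem_insert_iff]
    refine or_congr_right ⟨?_, ?_⟩
    · rintro ⟨⟨m, hm⟩, hx⟩
      have hx' := hdir (m * Real.pi / 3 - φ)
      rw [add_sub_cancel, ← hm] at hx'
      set t := m * Real.pi / 3 - φ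
      have hcos : Real.cos t = 1 / 2 := by
        rw [hx', add_dotProduct, smul_dotProduct, smul_dotProduct, hww, hbw] at hx
        simpa using hx
      have hsin : (Real.sin t - √3 / 2) * (Real.sin t + √3 / 2) = 0 := by
        have := Real.cos_sq_add_sin_sq t
        rw [hcos] at this
        linarith
      rw [hcos] at hx'
      rcases mul_eq_zero.mp hsin with h | h
      · left
        rw [hx', show Real.sin t = √3 / 2 by linarith]
      · right
        rw [hx', show Real.sin t = -(√3 / 2) by linarith]
    · have hdot : ∀ τ : ℝ, ((1 / 2 : ℝ) • w + τ • b) ⬝ᵥ w = 1 / 2 := by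
        intro τ
        rw [add_dotProduct, smul_dotProduct, smul_dotProduct, hww, hbw]
        simp
      rintro (rfl | rfl)
      · refine ⟨⟨n + 1, ?_⟩, hdot _⟩
        have := hdir (Real.pi / 3)
        rw [Real.cos_pi_div_three, Real.sin_pi_div_three] at this
        rw [← this]
        push_cast
        rw [show ((n : ℝ) + 1) * Real.pi / 3 = φ + Real.pi / 3 by simp only [φ]; ring]
      · refine ⟨⟨n - 1, ?_⟩, hdot _⟩
        have := hdir (-(Real.pi / 3))
        rw [Real.cos_neg, Real.sin_neg, Real.cos_pi_div_three, Real.sin_pi_div_three] at this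
        rw [← this]
        push_cast
        rw [show ((n : ℝ) - 1) * Real.pi / 3 = φ + -(Real.pi / 3) by simp only [φ]; ring]
  refine ⟨hp, ?_⟩
  rw [hset]
  rcases eq_cross_or_eq_neg_cross hp hbb hbn hbw with h | h
  · rw [h]
  · rw [h, Set.pair_comm]
    simp only [smul_neg, neg_smul, neg_neg]

/-! ### The gain condition and the assembly of the three cases. -/

/-- As `ξ ≤ 1`, the number under the root is at least 2. -/
theorem gain_sq_lt {ξ k : ℝ} (hξ0 : 0 ≤ ξ) (hξ1 : ξ ≤ 1) (hk : 0 < k)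
    (hk' : k < 1 / √(6 - max 1 (4 * ξ ^ 2))) : k ^ 2 < 1 / 2 := by
  have h1 : (2 : ℝ) ≤ 6 - max 1 (4 * ξ ^ 2) := by
    have : max 1 (4 * ξ ^ 2) ≤ 4 := max_le (by norm_num) (by nlinarith)
    linarith
  have h2 : k < 1 / √2 := hk'.trans_le
    (one_div_le_one_div_of_le (by positivity) (Real.sqrt_le_sqrt h1))
  have h3 := pow_lt_pow_left₀ h2 hk.le two_ne_zero
  rwa [div_pow, Real.sq_sqrt (by norm_num), one_pow] at h3

/-- The gap values are the largest gains at the possible critical configurations. -/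
theorem gapValues_eq_maxGains {g h k : ℝ} {n m : Vec} (hg : 0 < g) (hh : 0 ≤ h)
    (hm : IsPlanar n m) (hk : 0 < k) (hk2 : k ^ 2 < 1 / 2) {Q : Finset ℕ} {u : ℕ → Vec}
    {Qs : ℕ → Finset ℕ} {q : ℕ} {U : Set Vec} {Us : Vec → Set Vec} (hq : q ∈ Q)
    (hdir : HasDirections Q u Qs U Us) (hU : ∀ w ∈ U, w ⬝ᵥ w = 1) (hne : (Us (u q)).Nonempty) :
    gapValues Q (warpedV (axisMat g h n) k u) Qs q = maxGains g h k n (u q) (Us (u q)) := by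
  obtain ⟨h1, h2⟩ := hdir
  ext r
  exact mem_gapValues_iff hg hh hm.axis_unit hm.unit hm.orth hk hk2 hq
    (fun p hp => hU _ (h1 ▸ Set.mem_image_of_mem u hp)) (h2 q hq).1 (h2 q hq).2 hne r

theorem HasDirections.mem {Q : Finset ℕ} {u : ℕ → Vec} {Qs : ℕ → Finset ℕ} {q : ℕ} {U : Set Vec}
    {Us : Vec → Set Vec} (hdir : HasDirections Q u Qs U Us) (hq : q ∈ Q) : u q ∈ U :=
  hdir.1 ▸ Set.mem_image_of_mem u hq

theorem xi_axisMat {g h : ℝ} {n m : Vec} (hh : 0 ≤ h) (hm : IsPlanar n m) :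
    xi (axisMat g h n) = g / (g + h) := by
  rw [xi, lamMax_gMat_axisMat hh hm.axis_unit hm.unit hm.orth,
    lamMin_gMat_axisMat hh hm.axis_unit hm.unit hm.orth]

theorem axis_eigenvalue {g h g₃ : ℝ} {n : Vec} (hn : n ⬝ᵥ n = 1)
    (hg₃ : gMat (axisMat g h n) *ᵥ n = g₃ • n) : g₃ = g + h := by
  rw [gMat_axisMat_mulVec g h hn, hn] at hg₃
  have h1 := congrArg (fun x => x ⬝ᵥ n) hg₃
  simp only [add_dotProduct, smul_dotProduct, hn, smul_eq_mul] at h1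
  linarith

end Synergy
end

open Synergy in
theorem theorem2 (M : Mat) (hM : M.IsSymm) (hG : (gMat M).PosDef)
    (lam : Fin 3 → ℝ) (v : Fin 3 → Vec) (hv : IsOrthonormalEigenbasis M lam v)
    (g₃ : ℝ) (hg₃ : gMat M *ᵥ v 2 = g₃ • v 2)
    (k : ℝ) (hk : 0 < k) (hk' : k < 1 / √(6 - max 1 (4 * xi M ^ 2)))
    (Q : Finset ℕ) (u : ℕ → Vec) (Qs : ℕ → Finset ℕ) :
    (∀ μ : ℝ, 0 < μ → (∀ i, lam i = μ) →
      HasDirections Q u Qs (dirs6 v) (perpDirs (dirs6 v)) →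
      0 < gapTriple k μ ∧
      ∀ q ∈ Q,
        IsLeast (gapValues Q (warpedV M k u) Qs q) (deltaBar M k Q u Qs q) ∧
        deltaBar M k Q u Qs q = gapTriple k μ) ∧
    (lam 0 = lam 1 → lam 2 < lam 1 → 0 < lam 2 →
      HasDirections Q u Qs (dirs4 v) (perpDirs (dirs4 v)) →
      0 < gapFour k (xi M) g₃ ∧
      ∀ q ∈ Q,
        IsLeast (gapValues Q (warpedV M k u) Qs q) (deltaBar M k Q u Qs q) ∧
        deltaBar M k Q u Qs q = gapFour k (xi M) g₃) ∧
    (lam 0 = lam 1 → lam 2 < lam 1 → 0 ≤ lam 2 →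
      HasDirections Q u Qs (dirsHex v) (hexNeighbours (dirsHex v)) →
      0 < gapHex k (xi M) g₃ ∧
      ∀ q ∈ Q,
        IsLeast (gapValues Q (warpedV M k u) Qs q) (deltaBar M k Q u Qs q) ∧
        gapHex k (xi M) g₃ ≤ deltaBar M k Q u Qs q) := by
  have horth := hv.1
  have hm := isPlanar_of_ne horth (show (2 : Fin 3) ≠ 0 by decide)
  -- `L` and `L ξ` are the largest and smallest eigenvalues of `G` in the double-eigenvalue cases.
  -- The value `ξ > 1/2` or `ξ ≥ 1/2` later reflects `lam 2 > 0` or `lam 2 ≥ 0`.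
  have hform : lam 0 = lam 1 → ∀ L ξ, L = 2 * lam 0 → L * ξ = lam 0 + lam 2 →
      M = axisMat (L * ξ) (L * (1 - ξ)) (v 2) := by
    intro h01 L ξ hL hξ
    rw [eq_axisMat hv h01, hξ, mul_sub, hξ, hL]
    ring_nf
  have hleast : ∀ {S : Set ℝ} {t : ℝ}, IsLeast S t → IsLeast S (sInf S) ∧ sInf S = t :=
    fun h => ⟨h.csInf_eq.symm ▸ h, h.csInf_eq⟩
  refine ⟨?_, ?_, ?_⟩
  · intro μ hμ hlam hdir
    have hMa : M = axisMat (2 * μ) 0 (v 2) := by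
      rw [eq_axisMat hv (by rw [hlam, hlam]), hlam, hlam]
      ring_nf
    subst hMa
    have hk2 : k ^ 2 < 1 / 2 := by
      rw [xi_axisMat le_rfl hm, add_zero, div_self (by positivity)] at hk'
      exact gain_sq_lt zero_le_one le_rfl hk hk'
    have hk1 : k < 1 := by nlinarith
    refine ⟨gapTriple_pos hμ hk hk1, fun q hq => ?_⟩
    obtain ⟨a, ha, hN⟩ := perpDirs_dirs6 horth (hdir.mem hq)
    rw [deltaBar, gapValues_eq_maxGains (by positivity) le_rfl hm hk hk2 hq hdir
      (fun w hw => (perpDirs_dirs6 horth hw).choose_spec.1.axis_unit)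
      (hN ▸ Set.insert_nonempty _ _), hN]
    exact hleast (isLeast_maxGains_triple hμ hk hk1 ha)
  · intro h01 h21 h2 hdir
    obtain ⟨L, hL⟩ : ∃ L, L = 2 * lam 0 := ⟨_, rfl⟩
    obtain ⟨ξ, hξ⟩ : ∃ ξ, ξ = (lam 0 + lam 2) / L := ⟨_, rfl⟩
    have hL0 : 0 < L := by linarith
    have hLξ : L * ξ = lam 0 + lam 2 := by rw [hξ]; field_simp
    have hξ2 : 1 / 2 < ξ := by rw [hξ, lt_div_iff₀ hL0]; linarith
    have hξ1 : ξ < 1 := by rw [hξ, div_lt_one hL0]; linarith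
    have hMa := hform h01 L ξ hL hLξ
    have hh : 0 ≤ L * (1 - ξ) := mul_nonneg hL0.le (by linarith)
    have hLsum : L * ξ + L * (1 - ξ) = L := by ring
    rw [hMa] at hg₃ hk' ⊢
    have hxi : xi (axisMat (L * ξ) (L * (1 - ξ)) (v 2)) = ξ := by
      rw [xi_axisMat hh hm, hLsum]; field_simp
    rw [hxi] at hk' ⊢
    rw [axis_eigenvalue hm.axis_unit hg₃, hLsum]
    have hk2 := gain_sq_lt (by linarith) hξ1.le hk hk'
    have hk1 : k < 1 := by nlinarith
    refine ⟨gapFour_pos hL0 hξ2 hξ1 hk hk1, fun q hq => ?_⟩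
    obtain ⟨hp, hN⟩ := perpDirs_dirs4 horth (hdir.mem hq)
    rw [deltaBar, gapValues_eq_maxGains (by nlinarith) hh hm hk hk2 hq hdir
      (fun w hw => (perpDirs_dirs4 horth hw).1.unit) (hN ▸ Set.insert_nonempty _ _), hN]
    exact hleast (isLeast_maxGains_four hL0 hξ2 hξ1 hk hk2 hp)
  · intro h01 h21 h2 hdir
    obtain ⟨L, hL⟩ : ∃ L, L = 2 * lam 0 := ⟨_, rfl⟩
    obtain ⟨ξ, hξ⟩ : ∃ ξ, ξ = (lam 0 + lam 2) / L := ⟨_, rfl⟩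
    have hL0 : 0 < L := by linarith
    have hLξ : L * ξ = lam 0 + lam 2 := by rw [hξ]; field_simp
    have hξ2 : 1 / 2 ≤ ξ := by rw [hξ, le_div_iff₀ hL0]; linarith
    have hξ1 : ξ < 1 := by rw [hξ, div_lt_one hL0]; linarith
    have hMa := hform h01 L ξ hL hLξ
    have hh : 0 ≤ L * (1 - ξ) := mul_nonneg hL0.le (by linarith)
    have hLsum : L * ξ + L * (1 - ξ) = L := by ring
    rw [hMa] at hg₃ hk' ⊢
    have hxi : xi (axisMat (L * ξ) (L * (1 - ξ)) (v 2)) = ξ := by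
      rw [xi_axisMat hh hm, hLsum]; field_simp
    rw [hxi] at hk' ⊢
    rw [axis_eigenvalue hm.axis_unit hg₃, hLsum]
    have hk2 := gain_sq_lt (by linarith) hξ1.le hk hk'
    have hk1 : k < 1 := by nlinarith
    refine ⟨gapHex_pos hL0 hξ2 hξ1 hk hk1, fun q hq => ?_⟩
    obtain ⟨hp, hN⟩ := hexNeighbours_dirsHex horth (hdir.mem hq)
    rw [deltaBar, gapValues_eq_maxGains (by nlinarith) hh hm hk hk2 hq hdir
      (fun w hw => (hexNeighbours_dirsHex horth hw).1.unit) (hN ▸ Set.insert_nonempty _ _), hN]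
    -- With only a lower bound available, no minimizer is exhibited. Attainment comes from
    -- compactness, with the configuration `e = u q` showing that the set is nonempty.
    have hl := isLeast_isGreatest_gain
      (N := {-u q, (1 / 2 : ℝ) • u q + (√3 / 2) • (v 2 ⨯₃ u q),
        (1 / 2 : ℝ) • u q + (-(√3 / 2)) • (v 2 ⨯₃ u q)})
      (S := maxGains (L * ξ) (L * (1 - ξ)) k (v 2) (u q) _) (Set.toFinite _)
      (Set.insert_nonempty _ _) (fun r => Iff.rfl)
      ⟨_, _, _, equatorial_config (L := L) (by linarith) hξ1.le hk hk1 hp⟩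
    exact ⟨hl, gapHex_le hL0 hξ2 hξ1 hk hk2 hp hl.1⟩
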